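/- Let $k$ be an algebraically closed field of prime characteristic $p$, let $\delta\ge 2$ be an integer, and let $R=k[x^\delta,x^{\delta-1}y,\dots,y^\delta]\subseteq k[x,y]$ be the homogeneous coordinate ring of the rational normal curve of degree $\delta$, with homogeneous maximal ideal $\mathfrak m$ (the elements of $R$ with zero constant term). For a Noetherian ring $A$ of characteristic $p$ whose Frobenius map is finite, with a maximal ideal $\mathfrak n$ (either $A$ is local, or $A$ is standard graded over a field and $\mathfrak n$ is its homogeneous maximal ideal), put $d=\dim A$, $\kappa=A/\mathfrak n$ and $[\kappa:\kappa^p]=p^\alpha$, and for $e\ge 0$ let ${}^e\!A$ be $A$ regarded as an $A$-module through the $e$-fold iterated Frobenius map, $\mathfrak n^{[p^e]}$ the ideal generated by all $r^{p^e}$ with $r\in\mathfrak n$, $a_e$ the largest rank of a free direct summand of ${}^e\!A$, $\lambda$ the length of an $A$-module, and $\beta_i({}^e\!A)=\dim_\kappa \operatorname{Tor}_i^A({}^e\!A,\kappa)$. The $F$-signature, the Hilbert-Kunz multiplicity and the $i$-th Frobenius Betti number of $A$ are $$s(A)=\lim_{e\to\infty}\frac{a_e}{p^{(\alpha+d)e}},\qquad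 e_{HK}(A)=\lim_{e\to\infty}\frac{\lambda(A/\mathfrak n^{[p^e]})}{p^{de}},\qquad \beta_i^F(A)=\lim_{e\to\infty}\frac{\beta_i({}^e\!A)}{p^{(\alpha+d)e}}.$$ Then, both for $A=R$ with $\mathfrak n=\mathfrak m$ and for the local ring $A=R_{\mathfrak m}$ with its maximal ideal, the Frobenius map of $A$ is finite, these limits exist, and $$s(A)=\frac1\delta,\qquad e_{HK}(A)=\frac{\delta+1}{2},\qquad \beta_i^F(A)=\frac{\delta(\delta-1)^i}{2}\quad\text{for all } i\ge 1.$$ -/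

import Mathlib

open Filter Topology CategoryTheory

universe u

noncomputable section

namespace FrobeniusBetti

/-! ### Invariants of a ring of characteristic `p` with a distinguished maximal ideal

`(A, m)` is either a Noetherian local ring with its maximal ideal, or a standard graded algebra over
a field with its homogeneous maximal ideal. -/

/-- The `A`-module `ᵉA`: the ring `A` viewed as an `A`-module through the `e`-fold iterated
Frobenius, so that `r • x = r ^ (p ^ e) * x`. -/
def FrobPush (A : Type u) [CommRing A] (p : ℕ) [Fact p.Prime] [CharP A p] (_e : ℕ) : Type u := A

instance (A : Type u) [CommRing A] (p : ℕ) [Fact p.Prime] [CharP A p] (e : ℕ) :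
    AddCommGroup (FrobPush A p e) :=
  inferInstanceAs (AddCommGroup A)

instance (A : Type u) [CommRing A] (p : ℕ) [Fact p.Prime] [CharP A p] (e : ℕ) :
    Module A (FrobPush A p e) :=
  Module.compHom A (iterateFrobenius A p e)

theorem FrobPush.smul_def (A : Type u) [CommRing A] (p : ℕ) [Fact p.Prime] [CharP A p] (e : ℕ)
    (r : A) (x : FrobPush A p e) : r • x = (r ^ p ^ e * (show A from x) : A) := rfl

/-- The Frobenius power `I^[p^e]`, the ideal generated by all `r ^ (p ^ e)` with `r ∈ I`. -/
def frobPower {A : Type u} [CommRing A] (p : ℕ) (I : Ideal A) (e : ℕ) : Ideal A :=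
  Ideal.span ((fun r : A => r ^ p ^ e) '' (I : Set A))

theorem charP_quotient (A : Type u) [CommRing A] (p : ℕ) [Fact p.Prime] [CharP A p]
    (m : Ideal A) [m.IsMaximal] : CharP (A ⧸ m) p := by
  have h : ((p : ℕ) : A ⧸ m) = 0 := by
    rw [← map_natCast (Ideal.Quotient.mk m) p, CharP.cast_eq_zero, map_zero]
  have : Nontrivial (A ⧸ m) := Ideal.Quotient.nontrivial_iff.2 (Ideal.IsMaximal.ne_top ‹_›)
  exact (CharP.charP_iff_prime_eq_zero Fact.out).2 h

/-- The degree `[κ : κ^p]` of the residue field `κ = A / m` over its subfield of `p`-th powers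
(this is `p ^ α` in the usual normalization of the invariants below). -/
def residueDegree (p : ℕ) [Fact p.Prime] (A : Type u) [CommRing A] [CharP A p]
    (m : Ideal A) [m.IsMaximal] : ℕ :=
  letI : Field (A ⧸ m) := Ideal.Quotient.field m
  haveI : CharP (A ⧸ m) p := charP_quotient A p m
  Module.finrank (frobenius (A ⧸ m) p).fieldRange (A ⧸ m)

/-- `M` has a direct sum decomposition in which a free module of rank `n` is a summand. -/
def HasFreeSummand (A : Type u) [CommRing A] (M : Type u) [AddCommGroup M] [Module A M] (n : ℕ) :
    Prop :=
  ∃ P Q : Submodule A M, IsCompl P Q ∧ Nonempty (P ≃ₗ[A] (Fin n → A))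

/-- `s(A) = c`: for every `e` there is a largest rank `a e` of a free direct summand of `ᵉA`, and
`a e / p ^ ((α + d) e)` converges to `c`, where `d = dim A` and `p ^ α = [κ : κ^p]`. -/
def HasFSignature (p : ℕ) [Fact p.Prime] (A : Type u) [CommRing A] [CharP A p]
    (m : Ideal A) [m.IsMaximal] (c : ℝ) : Prop :=
  (frobenius A p).Finite ∧
  ∃ (d : ℕ) (a : ℕ → ℕ), ringKrullDim A = d ∧
    (∀ e, IsGreatest {n | HasFreeSummand A (FrobPush A p e) n} (a e)) ∧
    Tendsto (fun e : ℕ => (a e : ℝ) / ((residueDegree p A m : ℝ) ^ e * (p : ℝ) ^ (d * e)))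
      atTop (𝓝 c)

/-- `e_HK(A) = c`: the lengths of the `A / m^[p^e]` are finite, and divided by `p ^ (d e)`, with
`d = dim A`, they converge to `c`. -/
def HasHilbertKunzMultiplicity (p : ℕ) (A : Type u) [CommRing A] (m : Ideal A) (c : ℝ) : Prop :=
  ∃ (d : ℕ) (b : ℕ → ℕ), ringKrullDim A = d ∧
    (∀ e, Module.length A (A ⧸ frobPower p m e) = (b e : ℕ∞)) ∧
    Tendsto (fun e : ℕ => (b e : ℝ) / (p : ℝ) ^ (d * e)) atTop (𝓝 c)

/-- The `i`-th Betti number `dim_κ Tor_i(M, κ)` of `M`, with `κ = A / m`. As `Tor_i(M, κ)` is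
annihilated by `m`, its dimension over `κ` is its length as an `A`-module. -/
def betti (A : Type u) [CommRing A] (m : Ideal A) (i : ℕ) (M : Type u) [AddCommGroup M]
    [Module A M] : ℕ∞ :=
  Module.length A
    (((Tor' (ModuleCat.{u} A) i).obj (ModuleCat.of A M)).obj (ModuleCat.of A (A ⧸ m)))

/-- `β_i^F(A) = c`: the Betti numbers `β_i(ᵉA)` are finite, and divided by `p ^ ((α + d) e)`,
where `d = dim A` and `p ^ α = [κ : κ^p]`, they converge to `c`. -/
def HasFrobeniusBetti (p : ℕ) [Fact p.Prime] (A : Type u) [CommRing A] [CharP A p]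
    (m : Ideal A) [m.IsMaximal] (i : ℕ) (c : ℝ) : Prop :=
  (frobenius A p).Finite ∧
  ∃ (d : ℕ) (b : ℕ → ℕ), ringKrullDim A = d ∧
    (∀ e, betti A m i (FrobPush A p e) = (b e : ℕ∞)) ∧
    Tendsto (fun e : ℕ => (b e : ℝ) / ((residueDegree p A m : ℝ) ^ e * (p : ℝ) ^ (d * e)))
      atTop (𝓝 c)

/-! ### The coordinate ring of the rational normal curve -/

/-- The `k`-algebra `k[x^δ, x^(δ-1) y, …, y^δ] ⊆ k[x, y]`. -/
def ratNormalCurve (k : Type u) [Field k] (δ : ℕ) : Subalgebra k (MvPolynomial (Fin 2) k) :=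
  Algebra.adjoin k
    {f | ∃ a b : ℕ, a + b = δ ∧ f = MvPolynomial.X 0 ^ a * MvPolynomial.X 1 ^ b}

/-- The homogeneous maximal ideal: the elements with zero constant term. -/
def homMaxIdeal (k : Type u) [Field k] (δ : ℕ) : Ideal (ratNormalCurve k δ) :=
  RingHom.ker ((MvPolynomial.constantCoeff (R := k) (σ := Fin 2)).comp
    (ratNormalCurve k δ).toSubring.subtype)

instance homMaxIdeal_isMaximal (k : Type u) [Field k] (δ : ℕ) : (homMaxIdeal k δ).IsMaximal := by
  refine RingHom.ker_isMaximal_of_surjective _ fun c => ⟨algebraMap k (ratNormalCurve k δ) c, ?_⟩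
  exact MvPolynomial.constantCoeff_C (Fin 2) c

instance ratNormalCurve_charP (k : Type u) [Field k] (δ p : ℕ) [CharP k p] :
    CharP (ratNormalCurve k δ) p :=
  charP_of_injective_algebraMap (algebraMap k (ratNormalCurve k δ)).injective p

/-- The local ring of the rational normal curve's affine cone at its vertex. -/
abbrev ratNormalCurveLocal (k : Type u) [Field k] (δ : ℕ) : Type u :=
  Localization.AtPrime (homMaxIdeal k δ)

instance ratNormalCurveLocal_charP (k : Type u) [Field k] (δ p : ℕ) [CharP k p] :
    CharP (ratNormalCurveLocal k δ) p :=
  charP_of_injective_algebraMap (algebraMap k (ratNormalCurveLocal k δ)).injective p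

end FrobeniusBetti

end

open FrobeniusBetti

/-!
The Frobenius pushforward `ᵉA` of the rational normal curve is a direct sum of modules of
covariants `N_j`, the span in `k[x, y]` of the monomials of degree congruent to `j` modulo `δ`: put
`q = p ^ e`; as `k` is perfect, the `x ^ a y ^ b` with `a, b < q` form a basis of `k[x, y]` over its
subring of `q`-th powers, and such a monomial contributes the `N_j` with `δ ∣ q j + a + b`. Hence
each `0 ≤ j < δ` occurs about `q ^ 2 / δ` times.

The module `N_j` is minimally generated by the `j + 1` monomials of degree `j`, and their relations
`y · x ^ (j - i) y ^ i = x · x ^ (j - i - 1) y ^ (i + 1)` make its first syzygy module isomorphic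
to `N_{-1} ^ j`. The minimal resolution of `N_j` is then self-similar, and its Betti numbers are
`j + 1` and `j (δ - 1) ^ (i - 1) δ` for `i ≥ 1`. Moreover `N_0` is the ring and, for `0 < j < δ`,
every linear form on `N_j` takes values in the maximal ideal. Summing over `j`, the average number
of generators, of free summands and of `i`-th syzygies gives the three limits.
-/

noncomputable section

namespace FrobeniusBetti

open scoped TensorProduct

/-! ### Minimal syzygies and Betti numbers -/

section MinimalSyzygy

variable {A : Type u} [CommRing A]

/-- `K` is a syzygy module of `M` for a presentation `0 → K → A^ι → M → 0` which is minimal with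
respect to the ideal `m`, in the sense that `K` maps into `m A^ι`. -/
def IsMinimalSyzygy (m : Ideal A) (ι : Type) (K M : Type u) [AddCommGroup K] [Module A K]
    [AddCommGroup M] [Module A M] : Prop :=
  ∃ (f : K →ₗ[A] ι → A) (g : (ι → A) →ₗ[A] M), Function.Injective f ∧ Function.Exact f g ∧
    Function.Surjective g ∧ ∀ x i, f x i ∈ m

section Splice

variable (ι : ℕ → Type) (K : ℕ → Type u) [∀ n, AddCommGroup (K n)] [∀ n, Module A (K n)]
  (f : ∀ n, K (n + 1) →ₗ[A] ι n → A) (g : ∀ n, (ι n → A) →ₗ[A] K n)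

/-- The complex of free modules obtained by splicing the exact sequences
`K (n + 1) → A^(ι n) → K n` into one. -/
def splicedComplex (h : ∀ n, Function.Exact (f n) (g n)) : ChainComplex (ModuleCat.{u} A) ℕ :=
  ChainComplex.of (fun n => ModuleCat.of A (ι n → A))
    (fun n => ModuleCat.ofHom ((f n).comp (g (n + 1))))
    (fun n => by
      ext x : 2
      simp [(h (n + 1)).apply_apply_eq_zero])

variable (h : ∀ n, Function.Exact (f n) (g n))

theorem splicedComplex_d (n : ℕ) :
    (splicedComplex ι K f g h).d (n + 1) n = ModuleCat.ofHom ((f n).comp (g (n + 1))) :=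
  ChainComplex.of_d (fun n => ModuleCat.of A (ι n → A))
    (fun n => ModuleCat.ofHom ((f n).comp (g (n + 1)))) n

variable {ι K f g h} in
theorem exactAt_splicedComplex_succ (hf : ∀ n, Function.Injective (f n))
    (hg : ∀ n, Function.Surjective (g n)) (n : ℕ) :
    (splicedComplex ι K f g h).ExactAt (n + 1) := by
  rw [HomologicalComplex.exactAt_iff' _ (n + 2) (n + 1) n (by simp) (by simp),
    ShortComplex.moduleCat_exact_iff]
  intro x hx
  change ((splicedComplex ι K f g h).d (n + 1) n).hom x = 0 at hx
  rw [splicedComplex_d] at hx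
  obtain ⟨y, hy⟩ := (h (n + 1) x).1 ((map_eq_zero_iff (f n) (hf n)).1 hx)
  obtain ⟨z, rfl⟩ := hg (n + 2) y
  refine ⟨z, ?_⟩
  change ((splicedComplex ι K f g h).d (n + 1 + 1) (n + 1)).hom z = x
  rw [splicedComplex_d]
  exact hy

/-- The spliced complex, as a projective resolution of `K 0`. -/
def splicedResolution [∀ n, Finite (ι n)] (hf : ∀ n, Function.Injective (f n))
    (hg : ∀ n, Function.Surjective (g n)) : ProjectiveResolution (ModuleCat.of A (K 0)) where
  complex := splicedComplex ι K f g h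
  projective n := (IsProjective.iff_projective (ι n → A)).1 inferInstance
  π := ((splicedComplex ι K f g h).toSingle₀Equiv _).symm ⟨ModuleCat.ofHom (g 0), by
    rw [splicedComplex_d]
    exact ModuleCat.hom_ext (LinearMap.ext fun x => (h 0).apply_apply_eq_zero _)⟩
  quasiIso := ⟨fun n => by
    cases n with
    | zero =>
      rw [ChainComplex.quasiIsoAt₀_iff, ShortComplex.quasiIso_iff_of_zeros' _ rfl rfl rfl,
        ShortComplex.moduleCat_exact_iff, ModuleCat.epi_iff_surjective]
      refine ⟨fun x hx => ?_, hg 0⟩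
      obtain ⟨y, hy⟩ := (h 0 x).1 hx
      obtain ⟨z, rfl⟩ := hg 1 y
      refine ⟨z, ?_⟩
      change ((splicedComplex ι K f g h).d 1 0).hom z = x
      rw [splicedComplex_d]
      exact hy
    | succ n =>
      rw [quasiIsoAt_iff_exactAt' (hL := ChainComplex.exactAt_succ_single_obj ..)]
      exact exactAt_splicedComplex_succ hf hg n⟩

end Splice

theorem length_pi_quotient (m : Ideal A) [m.IsMaximal] (ι : Type*) [Finite ι] :
    Module.length A (ι → A ⧸ m) = Nat.card ι := by
  have := Fintype.ofFinite ι
  have : IsSimpleModule A (A ⧸ m) := isSimpleModule_iff_isCoatom.2 Ideal.IsMaximal.out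
  simp

theorem rTensor_quotient_eq_zero {m : Ideal A} {ι M : Type*} [Finite ι] [AddCommGroup M]
    [Module A M] {f : M →ₗ[A] ι → A} (hf : ∀ x i, f x i ∈ m) : f.rTensor (A ⧸ m) = 0 := by
  classical
  have := Fintype.ofFinite ι
  refine TensorProduct.ext' fun x y => (TensorProduct.piScalarRight A A (A ⧸ m) ι).injective.comp
    (TensorProduct.comm A _ _).injective (funext fun i => ?_)
  obtain ⟨y, rfl⟩ := Ideal.Quotient.mk_surjective y
  simp [Algebra.smul_def, Ideal.Quotient.eq_zero_iff_mem.2 (hf x i)]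

theorem length_pi_tensor_quotient (m : Ideal A) [m.IsMaximal] (ι : Type*) [Finite ι] :
    Module.length A ((ι → A) ⊗[A] (A ⧸ m)) = Nat.card ι := by
  classical
  have := Fintype.ofFinite ι
  rw [(TensorProduct.comm A _ _ ≪≫ₗ TensorProduct.piScalarRight A A (A ⧸ m) ι).length_eq,
    length_pi_quotient]

theorem betti_eq_card {m : Ideal A} [m.IsMaximal] (ι : ℕ → Type) [∀ n, Finite (ι n)]
    (K : ℕ → Type u) [∀ n, AddCommGroup (K n)] [∀ n, Module A (K n)]
    (h : ∀ n, IsMinimalSyzygy m (ι n) (K (n + 1)) (K n)) (i : ℕ) :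
    betti A m i (K 0) = Nat.card (ι i) := by
  choose f g hf hfg hg hm using h
  let F := (MonoidalCategory.tensoringRight (ModuleCat.{u} A)).obj (ModuleCat.of A (A ⧸ m))
  let P := splicedResolution ι K f g hfg hf hg
  have hd (a b : ℕ) : ((F.mapHomologicalComplex _).obj P.complex).d a b = 0 := by
    by_cases hab : b + 1 = a
    · subst hab
      change F.map ((splicedComplex ι K f g hfg).d (b + 1) b) = 0
      rw [splicedComplex_d]
      exact congrArg ModuleCat.ofHom
        (rTensor_quotient_eq_zero (f := (f b).comp (g (b + 1))) fun x i => hm b _ i)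
    · exact HomologicalComplex.shape _ _ _ hab
  let e := P.isoLeftDerivedObj F i ≪≫ (ShortComplex.HomologyData.ofZeros
    (((F.mapHomologicalComplex _).obj P.complex).sc i) (hd _ _) (hd _ _)).left.homologyIso
  have : betti A m i (K 0) = Module.length A ((ι i → A) ⊗[A] (A ⧸ m)) := e.toLinearEquiv.length_eq
  rw [this, length_pi_tensor_quotient]

namespace IsMinimalSyzygy

variable {m : Ideal A} {ι : Type} {K M K' M' : Type u} [AddCommGroup K] [Module A K]
  [AddCommGroup M] [Module A M] [AddCommGroup K'] [Module A K'] [AddCommGroup M'] [Module A M']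

theorem congr (h : IsMinimalSyzygy m ι K M) (e : K' ≃ₗ[A] K) (e' : M ≃ₗ[A] M') :
    IsMinimalSyzygy m ι K' M' := by
  obtain ⟨f, g, hf, hfg, hg, hm⟩ := h
  exact ⟨f.comp e.toLinearMap, e'.toLinearMap.comp g, hf.comp e.injective,
    e.surjective.comp_exact_iff_exact.2 (e'.injective.comp_exact_iff_exact.2 hfg),
    e'.surjective.comp hg, fun x i => hm _ i⟩

theorem pi {T : Type} {ι : T → Type} {K M : T → Type u} [∀ t, AddCommGroup (K t)]
    [∀ t, Module A (K t)] [∀ t, AddCommGroup (M t)] [∀ t, Module A (M t)]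
    (h : ∀ t, IsMinimalSyzygy m (ι t) (K t) (M t)) :
    IsMinimalSyzygy m (Σ t, ι t) (∀ t, K t) (∀ t, M t) := by
  choose f g hf hfg hg hm using h
  refine ⟨LinearMap.pi fun s => (LinearMap.proj s.2).comp ((f s.1).comp (LinearMap.proj s.1)),
    LinearMap.pi fun t => (g t).comp (LinearMap.pi fun i => LinearMap.proj ⟨t, i⟩),
    fun x y hxy => funext fun t => hf t (funext fun i => congrFun hxy ⟨t, i⟩),
    fun x => ⟨fun hx => ?_, ?_⟩, fun y => ?_, fun x s => hm s.1 _ s.2⟩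
  · choose y hy using fun t => (hfg t fun i => x ⟨t, i⟩).1 (congrFun hx t)
    exact ⟨y, funext fun s => congrFun (hy s.1) s.2⟩
  · rintro ⟨y, rfl⟩
    exact funext fun t => (hfg t).apply_apply_eq_zero (y t)
  · choose x hx using fun t => hg t (y t)
    exact ⟨fun s => x s.1 s.2, funext hx⟩

theorem finite [Finite ι] (h : IsMinimalSyzygy m ι K M) : Module.Finite A M := by
  obtain ⟨_, g, _, _, hg, _⟩ := h
  exact Module.Finite.of_surjective g hg

theorem length_quotient [m.IsMaximal] [Finite ι] (h : IsMinimalSyzygy m ι K M) :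
    Module.length A (M ⧸ (m • ⊤ : Submodule A M)) = Nat.card ι := by
  obtain ⟨f, g, _, hfg, hg, hm⟩ := h
  have hexact := rTensor_exact (A ⧸ m) hfg hg
  rw [rTensor_quotient_eq_zero hm, LinearMap.exact_zero_iff_injective] at hexact
  rw [← (TensorProduct.tensorQuotEquivQuotSMul M m).length_eq, ← length_pi_tensor_quotient m ι]
  exact (LinearEquiv.ofBijective _ ⟨hexact, LinearMap.rTensor_surjective _ hg⟩).length_eq.symm

theorem baseChange [Finite ι] (h : IsMinimalSyzygy m ι K M) (B : Type u) [CommRing B]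
    [Algebra A B] [Module.Flat A B] :
    IsMinimalSyzygy (m.map (algebraMap A B)) ι (B ⊗[A] K) (B ⊗[A] M) := by
  classical
  have := Fintype.ofFinite ι
  obtain ⟨f, g, hf, hfg, hg, hm⟩ := h
  let e := TensorProduct.piScalarRight A B B ι
  refine ⟨e.toLinearMap.comp (f.baseChange B), (g.baseChange B).comp e.symm.toLinearMap,
    e.injective.comp (Module.Flat.lTensor_preserves_injective_linearMap f hf), ?_,
    (LinearMap.lTensor_surjective B hg).comp e.symm.surjective, fun x i => ?_⟩
  · intro x
    refine (lTensor_exact B hfg hg (e.symm x)).trans (exists_congr fun y => ?_)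
    exact e.toEquiv.eq_symm_apply
  · induction x with
    | zero => simp
    | add x y hx hy => simpa using add_mem hx hy
    | tmul b x => simpa [e, Algebra.smul_def] using
        Ideal.mul_mem_right b _ (Ideal.mem_map_of_mem (algebraMap A B) (hm x i))

end IsMinimalSyzygy

theorem betti_succ_eq {m : Ideal A} [m.IsMaximal] {ι₀ ι X κ : Type} [Finite ι₀] [Finite ι]
    [Finite X] [Finite κ] {L M : Type u} [AddCommGroup L] [Module A L] [AddCommGroup M]
    [Module A M] (hM : IsMinimalSyzygy m ι₀ (X → L) M) (hL : IsMinimalSyzygy m ι (κ → L) L)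
    (i : ℕ) : betti A m (i + 1) M = (Nat.card X * Nat.card κ ^ i * Nat.card ι : ℕ) := by
  let ι' : ℕ → Type := fun | 0 => ι₀ | n + 1 => Σ _ : X × (Fin n → κ), ι
  let K : ℕ → ModuleCat.{u} A := fun | 0 => .of A M | n + 1 => .of A (X × (Fin n → κ) → L)
  have (n : ℕ) : Finite (ι' n) := by cases n <;> infer_instance
  have h (n : ℕ) : IsMinimalSyzygy m (ι' n) (K (n + 1)) (K n) := by
    cases n with
    | zero => exact hM.congr (.funCongrLeft A L (.symm (.prodUnique X (Fin 0 → κ)))) (.refl A M)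
    | succ n =>
      let e : (X × (Fin n → κ)) × κ ≃ X × (Fin (n + 1) → κ) :=
        (Equiv.prodAssoc ..).trans
          ((Equiv.refl X).prodCongr ((Equiv.prodComm ..).trans (Fin.consEquiv fun _ => κ)))
      exact (IsMinimalSyzygy.pi fun _ => hL).congr
        (.funCongrLeft A L e ≪≫ₗ .curry A L (X × (Fin n → κ)) κ) (.refl A _)
  have hcard : Nat.card (ι' (i + 1)) = Nat.card X * Nat.card κ ^ i * Nat.card ι := by
    simp only [ι', Nat.card_congr (Equiv.sigmaEquivProd (X × (Fin i → κ)) ι), Nat.card_prod,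
      Nat.card_fun, Nat.card_fin]
  rw [← hcard]
  exact betti_eq_card ι' (fun n => K n) h (i + 1)

end MinimalSyzygy

/-! ### Relations between the monomials of a given degree -/

section ShiftDifference

variable {A N P : Type*} [CommRing A] [AddCommGroup N] [Module A N] [AddCommGroup P] [Module A P]

/-- The map `t ↦ (a tᵢ - b tᵢ₋₁)ᵢ`, where `t` is extended by zero on both sides. If `a` and `b` are
the multiplications by `y` and `x`, it parametrizes the relations between the monomials
`x ^ (j - i) y ^ i` of degree `j`. -/
def shiftDifference (a b : N →ₗ[A] P) (j : ℕ) : (Fin j → N) →ₗ[A] Fin (j + 1) → P :=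
  LinearMap.pi fun i =>
    a ∘ₗ Fin.snoc (α := fun _ => (Fin j → N) →ₗ[A] N) LinearMap.proj 0 i -
      b ∘ₗ Fin.cons (α := fun _ => (Fin j → N) →ₗ[A] N) 0 LinearMap.proj i

theorem shiftDifference_apply (a b : N →ₗ[A] P) {j : ℕ} (t : Fin j → N) (i : Fin (j + 1)) :
    shiftDifference a b j t i =
      a (Fin.snoc (α := fun _ => N) t 0 i) - b (Fin.cons (α := fun _ => N) 0 t i) := by
  have h_snoc : Fin.snoc (α := fun _ => (Fin j → N) →ₗ[A] N) LinearMap.proj 0 i t =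
      Fin.snoc (α := fun _ => N) t 0 i := by
    refine Fin.lastCases ?_ (fun i => ?_) i <;> simp
  have h_cons : Fin.cons (α := fun _ => (Fin j → N) →ₗ[A] N) 0 LinearMap.proj i t =
      Fin.cons (α := fun _ => N) 0 t i := by
    refine Fin.cases ?_ (fun i => ?_) i <;> simp
  rw [← h_snoc, ← h_cons]
  rfl

theorem mem_of_shiftDifference_mem {a b : N →ₗ[A] P} {V : AddSubgroup N} {W : AddSubgroup P}
    (ha : ∀ s, a s ∈ W → s ∈ V) (hb : ∀ s ∈ V, b s ∈ W) {j : ℕ} {t : Fin j → N}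
    (h : ∀ i, shiftDifference a b j t i ∈ W) (i : Fin j) : t i ∈ V := by
  obtain ⟨n, rfl⟩ : ∃ n, j = n + 1 := ⟨j - 1, by have := i.2; omega⟩
  induction i using Fin.induction with
  | zero => exact ha _ (by simpa [shiftDifference_apply] using h (Fin.castSucc 0))
  | succ i ih =>
    have h_diff : a (t i.succ) - b (t i.castSucc) ∈ W := by
      have := h i.succ.castSucc
      rwa [shiftDifference_apply, Fin.snoc_castSucc, ← Fin.succ_castSucc, Fin.cons_succ] at this
    exact ha _ ((sub_add_cancel (a (t i.succ)) _) ▸ add_mem h_diff (hb _ ih))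

theorem shiftDifference_injective {a b : N →ₗ[A] P} (ha : Function.Injective a) (j : ℕ) :
    Function.Injective (shiftDifference a b j) := by
  refine (injective_iff_map_eq_zero _).2 fun t ht => funext ?_
  refine mem_of_shiftDifference_mem (a := a) (b := b) (V := ⊥) (W := ⊥)
    (fun s hs => (map_eq_zero_iff a ha).1 hs) ?_ fun i => congrFun ht i
  rintro _ rfl
  exact map_zero b

variable {S : Type*} [CommRing S]

theorem sum_shiftDifference_mul_pow_mul_pow (x y : S) {j : ℕ} (t : Fin j → S) :
    ∑ i : Fin (j + 1), shiftDifference (LinearMap.mulLeft S y) (LinearMap.mulLeft S x) j t i *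
      (x ^ (j - i : ℕ) * y ^ (i : ℕ)) = 0 := by
  simp only [shiftDifference_apply, LinearMap.mulLeft_apply, sub_mul, Finset.sum_sub_distrib]
  rw [Fin.sum_univ_castSucc, Fin.sum_univ_succ (fun i : Fin (j + 1) => x * _ * _)]
  simp only [Fin.snoc_castSucc, Fin.snoc_last, Fin.cons_succ, Fin.cons_zero, mul_zero, zero_mul,
    add_zero, zero_add]
  refine sub_eq_zero.2 (Finset.sum_congr rfl fun i _ => ?_)
  rw [Fin.val_castSucc, Fin.val_succ, show j - i = j - (i + 1) + 1 by omega, pow_succ, pow_succ]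
  ring

theorem exists_shiftDifference_eq_of_sum_eq_zero [IsDomain S] [DecompositionMonoid S] {x y : S}
    (hxy : IsRelPrime x y) (hy : y ≠ 0) (j : ℕ) (r : Fin (j + 1) → S)
    (h : ∑ i, r i * (x ^ (j - i : ℕ) * y ^ (i : ℕ)) = 0) :
    ∃ t, shiftDifference (LinearMap.mulLeft S y) (LinearMap.mulLeft S x) j t = r := by
  induction j with
  | zero =>
    refine ⟨Fin.elim0, funext fun i => ?_⟩
    simpa [Fin.fin_one_eq_zero i, shiftDifference_apply, Fin.snoc] using h.symm
  | succ j ih =>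
    have h_split : r 0 * x ^ (j + 1) +
        y * ∑ i : Fin (j + 1), r i.succ * (x ^ (j - i : ℕ) * y ^ (i : ℕ)) = 0 := by
      rw [← h, Fin.sum_univ_succ (n := j + 1), Finset.mul_sum]
      congr 1
      · simp
      · refine Finset.sum_congr rfl fun i _ => ?_
        rw [Fin.val_succ, Nat.add_sub_add_right, pow_succ]
        ring
    obtain ⟨t₀, ht₀⟩ : y ∣ r 0 := hxy.pow_left.symm.dvd_of_dvd_mul_right
      ⟨_, (eq_neg_of_add_eq_zero_left h_split).trans (mul_neg _ _).symm⟩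
    have h_tail : t₀ * x ^ (j + 1) +
        ∑ i : Fin (j + 1), r i.succ * (x ^ (j - i : ℕ) * y ^ (i : ℕ)) = 0 :=
      (mul_eq_zero.1 (by rw [← h_split, ht₀]; ring)).resolve_left hy
    obtain ⟨t, ht⟩ := ih (fun i => r i.succ + x * Fin.cons (α := fun _ => S) t₀ 0 i) (by
      simp only [add_mul, Finset.sum_add_distrib]
      rw [Fin.sum_univ_succ (fun i : Fin (j + 1) => x * Fin.cons (α := fun _ => S) t₀ 0 i * _)]
      simp only [Fin.cons_zero, Fin.cons_succ, Pi.zero_apply, mul_zero, zero_mul,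
        Finset.sum_const_zero, Fin.val_zero, pow_zero, mul_one, add_zero, Nat.sub_zero]
      rw [← h_tail, pow_succ]
      ring)
    refine ⟨Fin.cons t₀ t, funext fun i => ?_⟩
    rw [shiftDifference_apply, ← Fin.cons_snoc_eq_snoc_cons]
    refine Fin.cases (by simp [ht₀]) (fun i => ?_) i
    have ht_succ := congrFun ht i
    rw [shiftDifference_apply] at ht_succ
    rw [Fin.cons_succ, Fin.cons_succ, ← add_sub_cancel_right (r i.succ), ← ht_succ]
    refine Fin.cases ?_ (fun i => ?_) i <;> simp

end ShiftDifference

/-! ### Modules of covariants -/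

section Covariants

open MvPolynomial

theorem isWeightedHomogeneous_of_X_mul {R σ M : Type*} [CommSemiring R] [AddCommMonoid M]
    [IsLeftCancelAdd M] {w : σ → M} {c : M} {i : σ} {f : MvPolynomial σ R}
    (h : IsWeightedHomogeneous w (X i * f) (w i + c)) : IsWeightedHomogeneous w f c := by
  intro d hd
  have := h (d := Finsupp.single i 1 + d) (by rwa [coeff_X_mul])
  rw [map_add, Finsupp.weight_single, one_smul] at this
  exact add_left_cancel this

theorem isRelPrime_X_X {R σ : Type*} [CommRing R] [IsDomain R] {i i' : σ} (h : i ≠ i') :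
    IsRelPrime (X i : MvPolynomial σ R) (X i') :=
  X_prime.irreducible.isRelPrime_iff_not_dvd.2 (mt X_dvd_X.1 h)

variable {k : Type u} [Field k] {δ : ℕ}

theorem weight_one_fin_two (d : Fin 2 →₀ ℕ) :
    Finsupp.weight (1 : Fin 2 → ZMod δ) d = (d 0 + d 1 : ℕ) := by
  rw [Finsupp.weight_apply, Finsupp.sum_fintype _ _ (by simp), Fin.sum_univ_two]
  simp

theorem monomial_fin_two_eq (d : Fin 2 →₀ ℕ) (c : k) :
    monomial d c = C c * (X 0 ^ d 0 * X 1 ^ d 1) := by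
  rw [monomial_eq, Finsupp.prod_fintype _ _ (by simp), Fin.prod_univ_two]

theorem isWeightedHomogeneous_X_pow_mul_X_pow (a b : ℕ) :
    IsWeightedHomogeneous (1 : Fin 2 → ZMod δ) (X 0 ^ a * X 1 ^ b : MvPolynomial (Fin 2) k)
      (a + b : ℕ) := by
  simpa using ((isWeightedHomogeneous_X k (1 : Fin 2 → ZMod δ) 0).pow a).mul
    ((isWeightedHomogeneous_X k 1 1).pow b)

theorem X_pow_mul_X_pow_mem_ratNormalCurve {a b : ℕ} (h : δ ∣ a + b) :
    (X 0 ^ a * X 1 ^ b : MvPolynomial (Fin 2) k) ∈ ratNormalCurve k δ := by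
  obtain ⟨n, hn⟩ := h
  induction n generalizing a b with
  | zero =>
    obtain ⟨rfl, rfl⟩ : a = 0 ∧ b = 0 := by omega
    simp
  | succ n ih =>
    rw [Nat.mul_succ] at hn
    obtain ⟨a₁, a₂, b₁, b₂, rfl, rfl, h₁⟩ :
        ∃ a₁ a₂ b₁ b₂, a = a₁ + a₂ ∧ b = b₁ + b₂ ∧ a₁ + b₁ = δ :=
      ⟨min a δ, a - min a δ, δ - min a δ, b - (δ - min a δ), by omega, by omega, by omega⟩
    rw [pow_add, pow_add, mul_mul_mul_comm]
    exact mul_mem (Algebra.subset_adjoin ⟨a₁, b₁, h₁, rfl⟩) (ih (by omega))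

theorem mem_ratNormalCurve_iff {f : MvPolynomial (Fin 2) k} :
    f ∈ ratNormalCurve k δ ↔ IsWeightedHomogeneous (1 : Fin 2 → ZMod δ) f 0 := by
  refine ⟨fun hf => ?_, fun hf => ?_⟩
  · induction hf using Algebra.adjoin_induction with
    | mem f hf =>
      obtain ⟨a, b, hab, rfl⟩ := hf
      simpa [hab] using isWeightedHomogeneous_X_pow_mul_X_pow (k := k) (δ := δ) a b
    | algebraMap r => exact isWeightedHomogeneous_C _ r
    | add f g _ _ hf hg => exact hf.add hg
    | mul f g _ _ hf hg => simpa using hf.mul hg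
  · induction hf using IsWeightedHomogeneous.induction_on with
    | zero => exact zero_mem _
    | add f g _ _ hf hg => exact add_mem hf hg
    | monomial d c hd =>
      rw [weight_one_fin_two, ZMod.natCast_eq_zero_iff] at hd
      rw [monomial_fin_two_eq]
      exact mul_mem ((ratNormalCurve k δ).algebraMap_mem c) (X_pow_mul_X_pow_mem_ratNormalCurve hd)

theorem mem_homMaxIdeal_iff {r : ratNormalCurve k δ} :
    r ∈ homMaxIdeal k δ ↔ constantCoeff (r : MvPolynomial (Fin 2) k) = 0 := Iff.rfl

variable (k δ) in
/-- The module of covariants of class `c`: the direct sum of the homogeneous components of `k[x, y]`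
of degrees congruent to `c` modulo `δ`, a module over the rational normal curve. -/
def Covariants (c : ZMod δ) : Type u :=
  weightedHomogeneousSubmodule k (1 : Fin 2 → ZMod δ) c

namespace Covariants

variable {c : ZMod δ}

instance : AddCommGroup (Covariants k δ c) :=
  inferInstanceAs (AddCommGroup (weightedHomogeneousSubmodule k (1 : Fin 2 → ZMod δ) c))

instance : Module (ratNormalCurve k δ) (Covariants k δ c) where
  smul r f := ⟨r * f.1, by simpa using (mem_ratNormalCurve_iff.1 r.2).mul f.2⟩
  one_smul _ := Subtype.ext (one_mul _)
  mul_smul _ _ _ := Subtype.ext (mul_assoc _ _ _)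
  smul_zero _ := Subtype.ext (mul_zero _)
  smul_add _ _ _ := Subtype.ext (mul_add _ _ _)
  add_smul _ _ _ := Subtype.ext (add_mul _ _ _)
  zero_smul _ := Subtype.ext (zero_mul _)

/-- A homogeneous polynomial, as an element of the module of covariants of its class. -/
def mk (f : MvPolynomial (Fin 2) k) (hf : IsWeightedHomogeneous (1 : Fin 2 → ZMod δ) f c) :
    Covariants k δ c :=
  ⟨f, hf⟩

variable (k δ c) in
/-- The inclusion of a module of covariants into the polynomial ring. -/
def toPoly : Covariants k δ c →ₗ[ratNormalCurve k δ] MvPolynomial (Fin 2) k where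
  toFun := Subtype.val
  map_add' _ _ := rfl
  map_smul' _ _ := rfl

theorem toPoly_mk (f : MvPolynomial (Fin 2) k)
    (hf : IsWeightedHomogeneous (1 : Fin 2 → ZMod δ) f c) : toPoly k δ c (mk f hf) = f := rfl

theorem toPoly_injective : Function.Injective (toPoly k δ c) := Subtype.val_injective

theorem isWeightedHomogeneous_toPoly (f : Covariants k δ c) :
    IsWeightedHomogeneous (1 : Fin 2 → ZMod δ) (toPoly k δ c f) c := f.2

variable (k δ) in
/-- The generator `x ^ (j - i) y ^ i` of the module of covariants of class `j`. -/
def gen (j : ℕ) (i : Fin (j + 1)) : Covariants k δ j :=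
  mk (X 0 ^ (j - i : ℕ) * X 1 ^ (i : ℕ)) <| by
    simpa only [Nat.sub_add_cancel (Nat.lt_succ_iff.1 i.2)] using
      isWeightedHomogeneous_X_pow_mul_X_pow (k := k) (δ := δ) (j - i) i

theorem toPoly_gen (j : ℕ) (i : Fin (j + 1)) :
    toPoly k δ j (gen k δ j i) = X 0 ^ (j - i : ℕ) * X 1 ^ (i : ℕ) := rfl

theorem monomial_mem_map_span_gen {j : ℕ} {d : Fin 2 →₀ ℕ} (h : d 0 + d 1 ≡ j [MOD δ])
    (hle : j ≤ d 0 + d 1) (c : k) : monomial d c ∈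
      (Submodule.span (ratNormalCurve k δ) (Set.range (gen k δ j))).map (toPoly k δ j) := by
  obtain ⟨a, b, i, h₀, h₁, hi⟩ : ∃ a b i, d 0 = a + (j - i) ∧ d 1 = b + i ∧ i < j + 1 :=
    ⟨d 0 - min (d 0) j, d 1 - (j - min (d 0) j), j - min (d 0) j,
      by omega, by omega, by omega⟩
  have hr : C c * (X 0 ^ a * X 1 ^ b) ∈ ratNormalCurve k δ := by
    refine mul_mem ((ratNormalCurve k δ).algebraMap_mem c) (X_pow_mul_X_pow_mem_ratNormalCurve ?_)
    convert (Nat.modEq_iff_dvd' hle).1 h.symm using 1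
    omega
  refine ⟨(⟨_, hr⟩ : ratNormalCurve k δ) • gen k δ j ⟨i, hi⟩,
    Submodule.smul_mem _ _ (Submodule.subset_span ⟨_, rfl⟩), ?_⟩
  rw [map_smul, Subalgebra.smul_def, smul_eq_mul, toPoly_gen, monomial_fin_two_eq, h₀, h₁]
  ring

theorem span_gen {j : ℕ} (hj : j < δ) :
    Submodule.span (ratNormalCurve k δ) (Set.range (gen k δ j)) = ⊤ := by
  have key (f) (hf : IsWeightedHomogeneous (1 : Fin 2 → ZMod δ) f (j : ZMod δ)) :
      f ∈ (Submodule.span (ratNormalCurve k δ) (Set.range (gen k δ j))).map (toPoly k δ j) := by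
    induction hf using IsWeightedHomogeneous.induction_on with
    | zero => exact zero_mem _
    | add f g _ _ hf hg => exact add_mem hf hg
    | monomial d c hd =>
      rw [weight_one_fin_two, ZMod.natCast_eq_natCast_iff] at hd
      refine monomial_mem_map_span_gen hd ?_ c
      by_contra! hlt
      exact hlt.ne (hd.eq_of_lt_of_lt (hlt.trans hj) hj)
  refine Submodule.eq_top_iff'.2 fun f => ?_
  obtain ⟨g, hg, hgf⟩ := key _ (isWeightedHomogeneous_toPoly f)
  rwa [← toPoly_injective hgf]

variable (k δ) in
/-- Multiplication by a variable on the covariants of class `-1`, with values in the ring. -/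
def mulX (i : Fin 2) : Covariants k δ (-1) →ₗ[ratNormalCurve k δ] ratNormalCurve k δ where
  toFun t := ⟨X i * toPoly k δ (-1) t, mem_ratNormalCurve_iff.2 <| by
    simpa using (isWeightedHomogeneous_X k (1 : Fin 2 → ZMod δ) i).mul
      (isWeightedHomogeneous_toPoly t)⟩
  map_add' _ _ := Subtype.ext (mul_add _ _ _)
  map_smul' _ _ := Subtype.ext (mul_left_comm _ _ _)

variable (k δ) in
/-- The relations between the generators `gen k δ j`. -/
abbrev rel (j : ℕ) :
    (Fin j → Covariants k δ (-1)) →ₗ[ratNormalCurve k δ] Fin (j + 1) → ratNormalCurve k δ :=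
  shiftDifference (mulX k δ 1) (mulX k δ 0) j

theorem coe_rel_apply {j : ℕ} (t : Fin j → Covariants k δ (-1)) (i : Fin (j + 1)) :
    (rel k δ j t i : MvPolynomial (Fin 2) k) =
      shiftDifference (LinearMap.mulLeft (MvPolynomial (Fin 2) k) (X 1))
        (LinearMap.mulLeft (MvPolynomial (Fin 2) k) (X 0)) j (toPoly k δ (-1) ∘ t) i := by
  rw [shiftDifference_apply, shiftDifference_apply, ← map_zero (toPoly k δ (-1)), ← Fin.comp_snoc,
    ← Fin.comp_cons]
  rfl

theorem mulX_injective (i : Fin 2) : Function.Injective (mulX k δ i) := fun _ _ h =>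
  toPoly_injective (mul_left_cancel₀ (X_ne_zero i) (congrArg Subtype.val h))

theorem toPoly_linearCombination_gen {j : ℕ} (r : Fin (j + 1) → ratNormalCurve k δ) :
    toPoly k δ j (Fintype.linearCombination (ratNormalCurve k δ) (gen k δ j) r) =
      ∑ i, (r i : MvPolynomial (Fin 2) k) * (X 0 ^ (j - i : ℕ) * X 1 ^ (i : ℕ)) := by
  rw [Fintype.linearCombination_apply, map_sum]
  rfl

theorem exact_rel_linearCombination_gen (j : ℕ) :
    Function.Exact (rel k δ j) (Fintype.linearCombination (ratNormalCurve k δ) (gen k δ j)) := by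
  intro r
  rw [← toPoly_injective.eq_iff, map_zero, toPoly_linearCombination_gen]
  refine ⟨fun hr => ?_, ?_⟩
  · obtain ⟨t, ht⟩ := exists_shiftDifference_eq_of_sum_eq_zero
      (isRelPrime_X_X (by decide)) (X_ne_zero 1) j _ hr
    have ht_mem (i) : t i ∈ weightedHomogeneousSubmodule k (1 : Fin 2 → ZMod δ) (-1) := by
      refine mem_of_shiftDifference_mem (a := LinearMap.mulLeft (MvPolynomial (Fin 2) k) (X 1))
        (b := LinearMap.mulLeft (MvPolynomial (Fin 2) k) (X 0))
        (V := (weightedHomogeneousSubmodule k (1 : Fin 2 → ZMod δ) (-1)).toAddSubgroup)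
        (W := (weightedHomogeneousSubmodule k (1 : Fin 2 → ZMod δ) 0).toAddSubgroup)
        (fun s hs => ?_) (fun s hs => ?_) (fun i => ?_) i
      · exact isWeightedHomogeneous_of_X_mul (i := 1) (by simpa using hs)
      · simpa using (isWeightedHomogeneous_X k (1 : Fin 2 → ZMod δ) 0).mul hs
      · rw [ht]
        exact mem_ratNormalCurve_iff.1 (r i).2
    refine ⟨fun i => mk (t i) (ht_mem i), funext fun i => Subtype.ext ?_⟩
    rw [coe_rel_apply, ← congrFun ht i]
    rfl
  · rintro ⟨t, rfl⟩
    simp only [coe_rel_apply]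
    exact sum_shiftDifference_mul_pow_mul_pow _ _ _

theorem isMinimalSyzygy {j : ℕ} (hj : j < δ) :
    IsMinimalSyzygy (homMaxIdeal k δ) (Fin (j + 1)) (Fin j → Covariants k δ (-1))
      (Covariants k δ j) := by
  refine ⟨rel k δ j, Fintype.linearCombination _ (gen k δ j),
    shiftDifference_injective (mulX_injective 1) j, exact_rel_linearCombination_gen j, ?_,
    fun t i => ?_⟩
  · rw [← LinearMap.range_eq_top, Fintype.range_linearCombination, span_gen hj]
  · rw [mem_homMaxIdeal_iff, coe_rel_apply, shiftDifference_apply]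
    simp

end Covariants

end Covariants

/-! ### The Frobenius pushforward of the rational normal curve -/

section Decomposition

open MvPolynomial

theorem not_dvd_mul_add_sub {q n a b : ℕ} (ha : a < q) (hb : b < q) (hne : a ≠ b)
    (hle : a ≤ q * n + b) : ¬ q ∣ q * n + b - a := fun hdvd =>
  hne ((((Nat.modEq_iff_dvd' hle).2 hdvd).trans (by simp [Nat.ModEq])).eq_of_lt_of_lt ha hb)

/-- Hence the monomials with exponents less than `q = p ^ e` are linearly independent over the
`q`-th powers. -/
theorem coeff_pow_mul_monomial {R σ : Type*} [CommSemiring R] (p : ℕ) [ExpChar R p] (e : ℕ)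
    (f : MvPolynomial σ R) {a b : σ →₀ ℕ} (ha : ∀ i, a i < p ^ e) (hb : ∀ i, b i < p ^ e)
    (d : σ →₀ ℕ) [Decidable (a = b)] :
    coeff (p ^ e • d + b) (f ^ p ^ e * monomial a 1) =
      if a = b then coeff d f ^ p ^ e else 0 := by
  have hq : p ^ e ≠ 0 := (expChar_pow_pos R p e).ne'
  split_ifs with hab
  · rw [hab, coeff_mul_monomial, mul_one, ← map_iterateFrobenius_expand p f e, coeff_map,
      coeff_expand_smul _ hq, iterateFrobenius_def]
  · classical
    rw [coeff_mul_monomial']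
    split_ifs with hle
    · obtain ⟨i, hi⟩ := DFunLike.ne_iff.1 hab
      rw [mul_one, ← map_iterateFrobenius_expand p f e, coeff_map,
        coeff_expand_of_not_dvd _ (not_dvd_mul_add_sub (ha i) (hb i) hi (hle i)), map_zero]
    · rfl

/-- The index set of the decomposition of the Frobenius pushforward of the rational normal curve
into modules of covariants: `(j, (a, b))` stands for the copy of the module of covariants of class
`j` which is embedded by `f ↦ f ^ q * (x ^ a * y ^ b)`. -/
abbrev FrobIndex (q δ : ℕ) : Type :=
  Σ j : Fin δ, {ab : Fin q × Fin q // δ ∣ q * j + (ab.1 + ab.2)}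

namespace FrobIndex

variable {q δ : ℕ}

/-- The exponent of the monomial `x ^ a * y ^ b` attached to an index `(j, (a, b))`. -/
def exponent (t : FrobIndex q δ) : Fin 2 →₀ ℕ :=
  Finsupp.single 0 (t.2.1.1 : ℕ) + Finsupp.single 1 (t.2.1.2 : ℕ)

theorem exponent_zero (t : FrobIndex q δ) : t.exponent 0 = t.2.1.1 := by simp [exponent]

theorem exponent_one (t : FrobIndex q δ) : t.exponent 1 = t.2.1.2 := by simp [exponent]

theorem exponent_lt (t : FrobIndex q δ) (i : Fin 2) : t.exponent i < q := by
  fin_cases i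
  · exact t.exponent_zero ▸ t.2.1.1.2
  · exact t.exponent_one ▸ t.2.1.2.2

theorem ext_exponent {s t : FrobIndex q δ} (h₁ : (s.1 : ℕ) = t.1) (h₂ : s.exponent = t.exponent) :
    s = t := by
  obtain ⟨j, ⟨a, b⟩, hs⟩ := s
  obtain ⟨j', ⟨a', b'⟩, ht⟩ := t
  obtain rfl : j = j' := Fin.ext h₁
  obtain rfl : a = a' := Fin.ext (by simpa [exponent_zero] using DFunLike.congr_fun h₂ 0)
  obtain rfl : b = b' := Fin.ext (by simpa [exponent_one] using DFunLike.congr_fun h₂ 1)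
  rfl

theorem exists_eq_smul_add_exponent (hq : 0 < q) (hδ : 0 < δ) {d : Fin 2 →₀ ℕ}
    (hd : δ ∣ d 0 + d 1) : ∃ (t : FrobIndex q δ) (d' : Fin 2 →₀ ℕ),
      d = q • d' + t.exponent ∧ d' 0 + d' 1 ≡ t.1 [MOD δ] := by
  have h_eq : q * (d 0 / q + d 1 / q) + (d 0 % q + d 1 % q) = d 0 + d 1 := by
    rw [mul_add, add_add_add_comm, Nat.div_add_mod, Nat.div_add_mod]
  refine ⟨⟨⟨(d 0 / q + d 1 / q) % δ, Nat.mod_lt _ hδ⟩,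
    (⟨d 0 % q, Nat.mod_lt _ hq⟩, ⟨d 1 % q, Nat.mod_lt _ hq⟩), ?_⟩,
    d.mapRange (· / q) (Nat.zero_div q), ?_, ?_⟩
  · rw [← h_eq] at hd
    exact (((((Nat.mod_modEq _ δ).mul_left q).add_right _).dvd_iff dvd_rfl)).2 hd
  · ext i
    fin_cases i
    · simpa [exponent_zero] using (Nat.div_add_mod _ q).symm
    · simpa [exponent_one] using (Nat.div_add_mod _ q).symm
  · exact (Nat.mod_modEq _ δ).symm

end FrobIndex

variable {k : Type u} [Field k] (p : ℕ) [Fact p.Prime] [CharP k p] (e : ℕ) {δ : ℕ}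

/-- The polynomial underlying an element of the Frobenius pushforward. -/
def FrobPush.toPoly : FrobPush (ratNormalCurve k δ) p e →+ MvPolynomial (Fin 2) k :=
  (ratNormalCurve k δ).toSubring.subtype.toAddMonoidHom

theorem FrobPush.toPoly_injective :
    Function.Injective (FrobPush.toPoly (k := k) (δ := δ) p e) := Subtype.val_injective

/-- The embedding of a module of covariants into the Frobenius pushforward. -/
def frobSummand (t : FrobIndex (p ^ e) δ) :
    Covariants k δ (t.1 : ℕ) →ₗ[ratNormalCurve k δ] FrobPush (ratNormalCurve k δ) p e where
  toFun f := show ratNormalCurve k δ from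
    ⟨Covariants.toPoly k δ _ f ^ p ^ e * monomial t.exponent 1, mem_ratNormalCurve_iff.2 <| by
      have := (f.isWeightedHomogeneous_toPoly.pow (p ^ e)).mul
        (isWeightedHomogeneous_monomial (1 : Fin 2 → ZMod δ) t.exponent (1 : k) rfl)
      rwa [weight_one_fin_two, t.exponent_zero, t.exponent_one, nsmul_eq_mul, ← Nat.cast_mul,
        ← Nat.cast_add, (ZMod.natCast_eq_zero_iff _ δ).2 t.2.2] at this⟩
  map_add' f g := Subtype.ext <| by
    change Covariants.toPoly k δ _ (f + g) ^ p ^ e * _ = _ + _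
    rw [map_add, add_pow_expChar_pow, add_mul]
  map_smul' r f := Subtype.ext <| by
    change Covariants.toPoly k δ _ (r • f) ^ p ^ e * _ = r ^ p ^ e * (_ ^ p ^ e * _)
    rw [map_smul, Subalgebra.smul_def, smul_eq_mul, mul_pow, mul_assoc]

theorem toPoly_frobSummand (t : FrobIndex (p ^ e) δ) (f : Covariants k δ (t.1 : ℕ)) :
    FrobPush.toPoly p e (frobSummand p e t f) =
      Covariants.toPoly k δ _ f ^ p ^ e * monomial t.exponent 1 := rfl

variable (k δ) in
/-- The sum of the embeddings of the modules of covariants into the Frobenius pushforward. -/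
def frobSum : (∀ t : FrobIndex (p ^ e) δ, Covariants k δ (t.1 : ℕ)) →ₗ[ratNormalCurve k δ]
    FrobPush (ratNormalCurve k δ) p e :=
  ∑ t, frobSummand p e t ∘ₗ LinearMap.proj t

theorem frobSum_single (t : FrobIndex (p ^ e) δ) (f : Covariants k δ (t.1 : ℕ)) :
    frobSum k p e δ (Pi.single t f) = frobSummand p e t f := by
  rw [frobSum, LinearMap.sum_apply, Finset.sum_eq_single t] <;>
    simp +contextual [Pi.single_eq_of_ne]

theorem coeff_toPoly_frobSum (F : ∀ t : FrobIndex (p ^ e) δ, Covariants k δ (t.1 : ℕ))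
    (t : FrobIndex (p ^ e) δ) {d : Fin 2 →₀ ℕ} (hd : d 0 + d 1 ≡ t.1 [MOD δ]) :
    coeff (p ^ e • d + t.exponent) (FrobPush.toPoly p e (frobSum k p e δ F)) =
      coeff d (Covariants.toPoly k δ _ (F t)) ^ p ^ e := by
  classical
  rw [frobSum, LinearMap.sum_apply, map_sum, coeff_sum]
  simp only [LinearMap.comp_apply, LinearMap.proj_apply, toPoly_frobSummand,
    coeff_pow_mul_monomial p e _ (FrobIndex.exponent_lt _) t.exponent_lt]
  refine (Finset.sum_eq_single_of_mem t (Finset.mem_univ t) fun s _ hst => ?_).trans (if_pos rfl)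
  refine ite_eq_right_iff.2 fun h_exp => ?_
  have h_class : ¬ (s.1 : ℕ) ≡ t.1 [MOD δ] := fun h =>
    hst (FrobIndex.ext_exponent (h.eq_of_lt_of_lt s.1.2 t.1.2) h_exp)
  rw [(F s).isWeightedHomogeneous_toPoly.coeff_eq_zero d, zero_pow (expChar_pow_pos k p e).ne']
  rw [weight_one_fin_two, Ne, ZMod.natCast_eq_natCast_iff]
  exact fun h => h_class (h.symm.trans hd)

theorem frobSum_injective : Function.Injective (frobSum k p e δ) := by
  refine (injective_iff_map_eq_zero _).2 fun F hF => funext fun t =>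
    Covariants.toPoly_injective (MvPolynomial.ext _ _ fun d => ?_)
  rw [Pi.zero_apply, map_zero, coeff_zero]
  by_contra hne
  have hd : d 0 + d 1 ≡ t.1 [MOD δ] := by
    rw [← ZMod.natCast_eq_natCast_iff, ← weight_one_fin_two]
    exact (F t).isWeightedHomogeneous_toPoly hne
  have h_coeff := coeff_toPoly_frobSum p e F t hd
  rw [hF, map_zero, coeff_zero] at h_coeff
  exact hne (eq_zero_of_pow_eq_zero h_coeff.symm)

theorem frobSum_surjective [PerfectRing k p] (hδ : 0 < δ) :
    Function.Surjective (frobSum k p e δ) := by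
  have key (g) (hg : IsWeightedHomogeneous (1 : Fin 2 → ZMod δ) g (0 : ZMod δ)) :
      ∃ F, FrobPush.toPoly p e (frobSum k p e δ F) = g := by
    induction hg using IsWeightedHomogeneous.induction_on with
    | zero => exact ⟨0, by rw [map_zero, map_zero]⟩
    | add g₁ g₂ _ _ h₁ h₂ =>
      obtain ⟨F₁, rfl⟩ := h₁
      obtain ⟨F₂, rfl⟩ := h₂
      exact ⟨F₁ + F₂, by rw [map_add, map_add]⟩
    | monomial d c hd =>
      rw [weight_one_fin_two, ZMod.natCast_eq_zero_iff] at hd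
      obtain ⟨t, d', rfl, hd'⟩ :=
        FrobIndex.exists_eq_smul_add_exponent (expChar_pow_pos k p e) hδ hd
      obtain ⟨c, rfl⟩ := (bijective_iterateFrobenius k p e).2 c
      refine ⟨Pi.single t (Covariants.mk (monomial d' c) (isWeightedHomogeneous_monomial _ _ _ ?_)),
        ?_⟩
      · rwa [weight_one_fin_two, ZMod.natCast_eq_natCast_iff]
      · rw [frobSum_single, toPoly_frobSummand, Covariants.toPoly_mk, monomial_pow, monomial_mul,
          mul_one, iterateFrobenius_def]
  intro g
  obtain ⟨F, hF⟩ := key (FrobPush.toPoly p e g)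
    (mem_ratNormalCurve_iff.1 (show ratNormalCurve k δ from g).2)
  exact ⟨F, FrobPush.toPoly_injective p e hF⟩

variable (k δ) in
/-- The Frobenius pushforward of the rational normal curve is a direct sum of modules of
covariants. -/
def frobPushEquiv [PerfectRing k p] (hδ : 0 < δ) :
    (∀ t : FrobIndex (p ^ e) δ, Covariants k δ (t.1 : ℕ)) ≃ₗ[ratNormalCurve k δ]
      FrobPush (ratNormalCurve k δ) p e :=
  LinearEquiv.ofBijective (frobSum k p e δ) ⟨frobSum_injective p e, frobSum_surjective p e hδ⟩

end Decomposition

/-! ### Base change to a localization -/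

section Localization

variable (R : Type u) [CommRing R] (p : ℕ) [Fact p.Prime] (W : Submonoid R)
  (A : Type u) [CommRing A] [CharP A p] [Algebra R A] (e : ℕ)

namespace FrobPush

/-- Restriction of scalars of the Frobenius pushforward of an `R`-algebra to `R`. -/
abbrev moduleOfAlgebra : Module R (FrobPush A p e) := Module.compHom _ (algebraMap R A)

attribute [local instance] moduleOfAlgebra

theorem isScalarTower_of_algebra : IsScalarTower R A (FrobPush A p e) where
  smul_assoc r a x := by
    rw [Algebra.smul_def, mul_smul]
    rfl

attribute [local instance] isScalarTower_of_algebra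

variable [CharP R p]

/-- The map of Frobenius pushforwards induced by the structure map of an algebra. -/
def mapAlgebra : FrobPush R p e →ₗ[R] FrobPush A p e where
  toFun x := algebraMap R A x
  map_add' := map_add (algebraMap R A)
  map_smul' r x := by
    change algebraMap R A (r ^ p ^ e * (show R from x)) =
      algebraMap R A r ^ p ^ e * algebraMap R A x
    rw [map_mul, map_pow]

theorem isLocalizedModule_mapAlgebra [IsLocalization W A] :
    IsLocalizedModule W (mapAlgebra R p A e) where
  map_units w := by
    rw [← (Algebra.lsmul R R (FrobPush A p e) : A →ₐ[R] _).commutes]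
    exact (IsLocalization.map_units A w).map _
  surj y := by
    obtain ⟨⟨r, w⟩, h⟩ := IsLocalization.surj W (show A from y)
    refine ⟨((w : R) ^ (p ^ e - 1) * r, w), ?_⟩
    change (algebraMap R A w) ^ p ^ e * (show A from y) = algebraMap R A ((w : R) ^ (p ^ e - 1) * r)
    rw [map_mul, ← h, map_pow, mul_comm (show A from y), ← mul_assoc, ← pow_succ,
      Nat.sub_add_cancel (expChar_pow_pos R p e)]
  exists_of_eq {x y} hxy := by
    obtain ⟨c, hc⟩ := (IsLocalization.eq_iff_exists W A).1 hxy
    refine ⟨c, ?_⟩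
    change (c : R) ^ p ^ e * (show R from x) = (c : R) ^ p ^ e * (show R from y)
    rw [← Nat.sub_add_cancel (expChar_pow_pos R p e), pow_succ, mul_assoc, mul_assoc]
    exact congrArg _ hc

/-- Frobenius pushforwards commute with localization. -/
def tensorEquiv [IsLocalization W A] : A ⊗[R] FrobPush R p e ≃ₗ[A] FrobPush A p e :=
  have := isLocalizedModule_mapAlgebra R p W A e
  (IsLocalizedModule.isBaseChange W A (mapAlgebra R p A e)).equiv

end FrobPush

variable {R A} in
theorem apply_mem_of_span_eq_top {M : Type*} [AddCommGroup M] [Module R M] {n : Ideal A} {G : Set M}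
    (hG : Submodule.span R G = ⊤) (h : ∀ g : M →ₗ[R] A, ∀ u ∈ G, g u ∈ n)
    (f : A ⊗[R] M →ₗ[A] A) (x : A ⊗[R] M) : f x ∈ n := by
  have h_span : Submodule.span A (TensorProduct.mk R A M 1 '' G) = ⊤ := by
    rw [← Submodule.baseChange_span, hG, Submodule.baseChange_top]
  have h_le : Submodule.span A (TensorProduct.mk R A M 1 '' G) ≤ Submodule.comap f n := by
    rw [Submodule.span_le]
    rintro _ ⟨u, hu, rfl⟩
    exact h (f.restrictScalars R ∘ₗ TensorProduct.mk R A M 1) u hu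
  exact h_le (h_span ▸ Submodule.mem_top)

end Localization

/-! ### Length and restriction of scalars -/

section Length

theorem length_eq_of_length_quotient_eq_one {A B : Type*} [CommRing A] [CommRing B] [Algebra A B]
    {J : Ideal B} (h : ∀ I : Ideal B, I.IsMaximal → J ≤ I → Module.length A (B ⧸ I) = 1)
    {V : Type*} [AddCommGroup V] [Module A V] [Module B V] [IsScalarTower A B V]
    (hJ : J ≤ Module.annihilator B V) : Module.length A V = Module.length B V := by
  by_cases hV : Module.length B V = ⊤
  · rw [hV, ← top_le_iff, ← hV, ← Module.length_top (R := B), ← Module.length_top (R := A)]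
    exact Submodule.length_le_length_restrictScalars A (⊤ : Submodule B V)
  replace hV := Module.length_ne_top_iff.1 hV
  revert ‹Module A V› ‹IsScalarTower A B V› hJ
  induction hV with
  | of_subsingleton =>
    intros
    rw [Module.length_eq_zero, Module.length_eq_zero]
  | @of_simple_quotient V _ _ N h_simple _ ih =>
    intro _ _ hJ
    have h_quot : Module.length A (V ⧸ N) = 1 := by
      obtain ⟨I, hI, ⟨ε⟩⟩ := isSimpleModule_iff_quot_maximal.1 h_simple
      rw [(ε.restrictScalars A).length_eq]
      refine h I hI ?_
      rw [← I.annihilator_quotient, ← ε.annihilator_eq]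
      exact hJ.trans (N.mkQ.annihilator_le_of_surjective N.mkQ_surjective)
    have h_exact : Function.Exact N.subtype N.mkQ := LinearMap.exact_subtype_mkQ N
    rw [Module.length_eq_add_of_exact N.subtype N.mkQ N.injective_subtype N.mkQ_surjective h_exact,
      Module.length_eq_add_of_exact (N.subtype.restrictScalars A) (N.mkQ.restrictScalars A)
        N.injective_subtype N.mkQ_surjective h_exact, h_quot, Module.length_eq_one B (V ⧸ N)]
    exact congrArg (· + 1)
      (ih (hJ.trans (N.subtype.annihilator_le_of_injective N.injective_subtype)))

/-- The ring `A` viewed as an algebra over itself through the iterated Frobenius; its underlying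
module is `FrobPush A p e`. -/
def FrobRing (A : Type u) (_p _e : ℕ) : Type u := A

variable {A : Type u} [CommRing A] (p : ℕ) [Fact p.Prime] [CharP A p] (e : ℕ)

instance : CommRing (FrobRing A p e) := inferInstanceAs (CommRing A)

instance : Algebra A (FrobRing A p e) := (iterateFrobenius A p e).toAlgebra

theorem length_quotient_frobRing_eq_one (n : Ideal A) [n.IsMaximal]
    (h_perf : Function.Surjective fun x : A ⧸ n => x ^ p ^ e) (I : Ideal (FrobRing A p e))
    (hI : I.IsMaximal) (hnI : n.map (algebraMap A (FrobRing A p e)) ≤ I) :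
    Module.length A (FrobRing A p e ⧸ I) = 1 := by
  have h_eq : n = (I : Ideal A) := ‹n.IsMaximal›.eq_of_le hI.ne_top fun b hb =>
    hI.isPrime.mem_of_pow_mem (p ^ e) (hnI (Ideal.mem_map_of_mem _ hb))
  have h_surj : Function.Surjective (algebraMap A (FrobRing A p e ⧸ I)) := by
    subst h_eq
    intro y
    obtain ⟨x, rfl⟩ := h_perf y
    obtain ⟨a, rfl⟩ := Ideal.Quotient.mk_surjective x
    exact ⟨a, rfl⟩
  let _ : Field (FrobRing A p e ⧸ I) := Ideal.Quotient.field I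
  rw [Module.length_eq_of_surjective (R := FrobRing A p e ⧸ I) h_surj]
  exact Module.length_eq_one _ _

theorem length_quotient_frobPower (n : Ideal A) [n.IsMaximal]
    (h_perf : Function.Surjective fun x : A ⧸ n => x ^ p ^ e) :
    Module.length A (A ⧸ frobPower p n e) =
      Module.length A (FrobPush A p e ⧸ (n • ⊤ : Submodule A (FrobPush A p e))) := by
  let J : Ideal (FrobRing A p e) := n.map (algebraMap A (FrobRing A p e))
  calc Module.length A (A ⧸ frobPower p n e)
      = Module.length (FrobRing A p e) (FrobRing A p e ⧸ J) := rfl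
    _ = Module.length A (FrobRing A p e ⧸ J) :=
        (length_eq_of_length_quotient_eq_one (length_quotient_frobRing_eq_one p e n h_perf)
          J.annihilator_quotient.ge).symm
    _ = Module.length A (FrobRing A p e ⧸ J.restrictScalars A) :=
        (Submodule.Quotient.restrictScalarsEquiv A J).length_eq.symm
    _ = Module.length A (FrobRing A p e ⧸ (n • ⊤ : Submodule A (FrobRing A p e))) := by
        rw [Ideal.smul_top_eq_map]
    _ = Module.length A (FrobPush A p e ⧸ (n • ⊤ : Submodule A (FrobPush A p e))) := rfl

end Length

/-! ### Free direct summands -/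

section FreeSummand

variable {A : Type u} [CommRing A] {M M' : Type u} [AddCommGroup M] [Module A M]
  [AddCommGroup M'] [Module A M'] {c : ℕ}

theorem hasFreeSummand_iff_exists_surjective :
    HasFreeSummand A M c ↔ ∃ π : M →ₗ[A] Fin c → A, Function.Surjective π := by
  refine ⟨fun ⟨P, Q, hPQ, ⟨ε⟩⟩ => ⟨ε.toLinearMap ∘ₗ P.projectionOnto Q hPQ,
    ε.surjective.comp (Submodule.projectionOnto_surjective hPQ)⟩, fun ⟨π, hπ⟩ => ?_⟩
  obtain ⟨i, hi⟩ := Module.projective_lifting_property π LinearMap.id hπ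
  have h_inj : Function.Injective i := Function.LeftInverse.injective (LinearMap.congr_fun hi)
  have h_idem : IsIdempotentElem (i ∘ₗ π) := by
    change (i ∘ₗ π) ∘ₗ i ∘ₗ π = i ∘ₗ π
    rw [LinearMap.comp_assoc, ← LinearMap.comp_assoc π, hi, LinearMap.id_comp]
  have h_range : LinearMap.range (i ∘ₗ π) = LinearMap.range i :=
    LinearMap.range_comp_of_range_eq_top i (LinearMap.range_eq_top.2 hπ)
  exact ⟨_, _, LinearMap.IsIdempotentElem.isCompl h_idem,
    ⟨(LinearEquiv.ofEq _ _ h_range).trans (LinearEquiv.ofInjective i h_inj).symm⟩⟩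

theorem HasFreeSummand.congr (h : HasFreeSummand A M c) (ε : M ≃ₗ[A] M') :
    HasFreeSummand A M' c := by
  rw [hasFreeSummand_iff_exists_surjective] at h ⊢
  obtain ⟨π, hπ⟩ := h
  exact ⟨π ∘ₗ ε.symm.toLinearMap, hπ.comp ε.symm.surjective⟩

theorem hasFreeSummand_congr (ε : M ≃ₗ[A] M') : HasFreeSummand A M c ↔ HasFreeSummand A M' c :=
  ⟨fun h => h.congr ε, fun h => h.congr ε.symm⟩

variable {T : Type} [Finite T] {N : T → Type u} [∀ t, AddCommGroup (N t)] [∀ t, Module A (N t)]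
  {F : T → Prop}

theorem hasFreeSummand_card (hF : ∀ t, F t → Nonempty (N t ≃ₗ[A] A)) :
    HasFreeSummand A (∀ t, N t) (Nat.card {t // F t}) := by
  let π : (∀ t, N t) →ₗ[A] {t // F t} → A :=
    LinearMap.pi fun t => (hF t t.2).some.toLinearMap ∘ₗ LinearMap.proj t.1
  have hπ : Function.Surjective π := by
    classical
    intro x
    refine ⟨fun t => if h : F t then (hF t h).some.symm (x ⟨t, h⟩) else 0, funext fun t => ?_⟩
    simp [π, t.2]
  let σ : {t // F t} ≃ Fin (Nat.card {t // F t}) := Finite.equivFin _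
  exact hasFreeSummand_iff_exists_surjective.2
    ⟨(LinearEquiv.funCongrLeft A A σ.symm).toLinearMap ∘ₗ π,
      (LinearEquiv.funCongrLeft A A σ.symm).surjective.comp hπ⟩

theorem HasFreeSummand.le_card {m : Ideal A} [m.IsMaximal]
    (hF : ∀ t, F t → Nonempty (N t ≃ₗ[A] A))
    (h_not : ∀ t, ¬ F t → ∀ (f : N t →ₗ[A] A) (x : N t), f x ∈ m)
    (h : HasFreeSummand A (∀ t, N t) c) : c ≤ Nat.card {t // F t} := by
  classical
  have := Fintype.ofFinite T
  let _ : Field (A ⧸ m) := Ideal.Quotient.field m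
  obtain ⟨π, hπ⟩ := hasFreeSummand_iff_exists_surjective.1 h
  let reduce : (Fin c → A) →ₗ[A] Fin c → A ⧸ m := (m.mkQ).compLeft (Fin c)
  have h_reduce : Function.Surjective reduce := fun y =>
    ⟨fun s => (y s).out, funext fun s => Ideal.Quotient.mk_out (y s)⟩
  let v : {t // F t} → Fin c → A ⧸ m := fun t =>
    reduce (π (Pi.single t.1 ((hF t t.2).some.symm 1)))
  have h_single (t : T) (x : N t) :
      reduce (π (Pi.single t x)) ∈ Submodule.span (A ⧸ m) (Set.range v) := by
    by_cases ht : F t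
    · have hx : x = (hF t ht).some x • (hF t ht).some.symm 1 := by
        rw [← map_smul, smul_eq_mul, mul_one, LinearEquiv.symm_apply_apply]
      rw [hx, Pi.single_smul, map_smul, map_smul]
      exact Submodule.smul_of_tower_mem _ _ (Submodule.subset_span ⟨⟨t, ht⟩, rfl⟩)
    · convert Submodule.zero_mem _
      refine funext fun s => Ideal.Quotient.eq_zero_iff_mem.2 ?_
      exact h_not t ht (LinearMap.proj s ∘ₗ π ∘ₗ LinearMap.single A N t) x
  have h_span : ⊤ ≤ Submodule.span (A ⧸ m) (Set.range v) := fun y _ => by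
    obtain ⟨x, rfl⟩ := h_reduce.comp hπ y
    rw [Function.comp_apply, ← Finset.univ_sum_single x, map_sum, map_sum]
    exact Submodule.sum_mem _ fun t _ => h_single t (x t)
  rw [Nat.card_eq_fintype_card, ← Module.finrank_fin_fun (A ⧸ m) (n := c)]
  exact finrank_le_of_span_eq_top (top_le_iff.1 h_span)

end FreeSummand

/-! ### Counting the summands -/

section Counting

variable {δ : ℕ}

theorem abs_count_dvd_add_sub_le (hδ : 0 < δ) (q c : ℕ) :
    |(q.count fun b => δ ∣ c + b : ℝ) - q / δ| ≤ 1 := by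
  have h_ceil (n : ℕ) : (n.count (δ ∣ ·) : ℤ) = ⌈(n : ℝ) / δ⌉ := by
    have := Nat.count_modEq_card_eq_ceil n hδ 0
    simp only [Nat.modEq_zero_iff_dvd, Nat.zero_mod, Nat.cast_zero, sub_zero] at this
    rw [this, ← Rat.ceil_cast (α := ℝ), Rat.cast_div, Rat.cast_natCast, Rat.cast_natCast]
  have h_add : (q.count fun b => δ ∣ c + b : ℝ) = ⌈((c + q : ℕ) : ℝ) / δ⌉ - ⌈(c : ℝ) / δ⌉ := by
    rw [← h_ceil, ← h_ceil, Nat.count_add]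
    push_cast
    ring
  rw [h_add, Nat.cast_add, add_div, abs_le]
  have := Int.le_ceil ((c : ℝ) / δ + q / δ)
  have := Int.ceil_lt_add_one ((c : ℝ) / δ + q / δ)
  have := Int.le_ceil ((c : ℝ) / δ)
  have := Int.ceil_lt_add_one ((c : ℝ) / δ)
  constructor <;> linarith

theorem abs_card_dvd_add_add_sub_le (hδ : 0 < δ) (q c : ℕ) :
    |(Nat.card {ab : Fin q × Fin q // δ ∣ c + (ab.1 + ab.2)} : ℝ) - q * (q / δ)| ≤ q := by
  have h_card : Nat.card {ab : Fin q × Fin q // δ ∣ c + (ab.1 + ab.2)} =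
      ∑ a ∈ Finset.range q, q.count fun b => δ ∣ (c + a) + b := by
    simp only [Nat.count_eq_card_filter_range, Finset.card_filter]
    rw [Nat.card_eq_fintype_card, Fintype.card_subtype, Finset.card_filter, Fintype.sum_prod_type,
      ← Fin.sum_univ_eq_sum_range]
    refine Finset.sum_congr rfl fun a _ => ?_
    rw [← Fin.sum_univ_eq_sum_range]
    simp only [add_assoc]
  have h_const : (q * (q / δ) : ℝ) = ∑ _a ∈ Finset.range q, (q / δ : ℝ) := by simp
  rw [h_card, Nat.cast_sum, h_const, ← Finset.sum_sub_distrib]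
  calc |∑ a ∈ Finset.range q, ((q.count fun b => δ ∣ (c + a) + b : ℝ) - q / δ)|
      ≤ ∑ a ∈ Finset.range q, |(q.count fun b => δ ∣ (c + a) + b : ℝ) - q / δ| :=
        Finset.abs_sum_le_sum_abs _ _
    _ ≤ ∑ _a ∈ Finset.range q, (1 : ℝ) :=
        Finset.sum_le_sum fun a _ => abs_count_dvd_add_sub_le hδ q (c + a)
    _ = q := by simp

theorem tendsto_card_dvd_add_add_div (hδ : 0 < δ) {p : ℕ} (hp : 1 < p) (c : ℕ → ℕ) :
    Tendsto (fun e : ℕ => (Nat.card {ab : Fin (p ^ e) × Fin (p ^ e) // δ ∣ c e + (ab.1 + ab.2)} : ℝ)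
      / (p : ℝ) ^ (2 * e)) atTop (𝓝 (1 / δ)) := by
  have h_inv : Tendsto (fun e : ℕ => ((p : ℝ) ^ e)⁻¹) atTop (𝓝 0) :=
    tendsto_inv_atTop_zero.comp (tendsto_pow_atTop_atTop_of_one_lt (by exact_mod_cast hp))
  refine tendsto_iff_dist_tendsto_zero.2 (squeeze_zero (fun _ => dist_nonneg) (fun e => ?_) h_inv)
  have h_le := abs_card_dvd_add_add_sub_le hδ (p ^ e) (c e)
  set N := Nat.card {ab : Fin (p ^ e) × Fin (p ^ e) // δ ∣ c e + (ab.1 + ab.2)}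
  push_cast at h_le
  have h_sub : (N : ℝ) / (p : ℝ) ^ (2 * e) - 1 / δ =
      (N - (p : ℝ) ^ e * ((p : ℝ) ^ e / δ)) / (p : ℝ) ^ (2 * e) := by
    rw [pow_mul']
    field_simp
  calc dist ((N : ℝ) / (p : ℝ) ^ (2 * e)) (1 / δ)
      = |N - (p : ℝ) ^ e * ((p : ℝ) ^ e / δ)| / (p : ℝ) ^ (2 * e) := by
        rw [Real.dist_eq, h_sub, abs_div, abs_of_pos (by positivity : (0 : ℝ) < (p : ℝ) ^ (2 * e))]
    _ ≤ (p : ℝ) ^ e / (p : ℝ) ^ (2 * e) := by gcongr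
    _ = ((p : ℝ) ^ e)⁻¹ := by
        rw [pow_mul']
        field_simp

theorem tendsto_sum_frobIndex_div (hδ : 0 < δ) {p : ℕ} (hp : 1 < p) (h : Fin δ → ℝ) :
    Tendsto (fun e : ℕ => (∑ t : FrobIndex (p ^ e) δ, h t.1) / (p : ℝ) ^ (2 * e)) atTop
      (𝓝 ((∑ j, h j) / δ)) := by
  have h_lim := tendsto_finsetSum Finset.univ fun j _ =>
    (tendsto_card_dvd_add_add_div hδ hp fun e => p ^ e * (j : Fin δ)).const_mul (h j)
  refine (h_lim.congr fun e => ?_).trans_eq ?_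
  · rw [Fintype.sum_sigma, Finset.sum_div]
    refine Finset.sum_congr rfl fun j _ => ?_
    simp only [Finset.sum_const, Finset.card_univ, nsmul_eq_mul, Nat.card_eq_fintype_card]
    ring
  · rw [Finset.sum_div]
    simp only [mul_one_div]

end Counting

/-! ### Localizations of the rational normal curve at its vertex -/

section Vertex

open MvPolynomial

theorem residueDegree_eq_one {p : ℕ} [Fact p.Prime] {A : Type u} [CommRing A] [CharP A p]
    {n : Ideal A} [n.IsMaximal] (h_perf : Function.Surjective fun x : A ⧸ n => x ^ p) :
    residueDegree p A n = 1 := by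
  let _ : Field (A ⧸ n) := Ideal.Quotient.field n
  have : CharP (A ⧸ n) p := charP_quotient A p n
  refine _root_.finrank_eq_one (R := (frobenius (A ⧸ n) p).fieldRange) 1 one_ne_zero fun w => ?_
  obtain ⟨v, hv⟩ := h_perf w
  exact ⟨⟨w, v, hv⟩, mul_one w⟩

theorem le_primeCompl_of_liesOver {R A : Type*} [CommRing R] [CommRing A] [Algebra R A]
    (W : Submonoid R) [IsLocalization W A] {m : Ideal R} [m.IsPrime] {n : Ideal A} [n.LiesOver m]
    (hn : n ≠ ⊤) : W ≤ m.primeCompl := fun _ hw hm =>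
  ((IsLocalization.disjoint_under_iff W A n).2 hn).le_bot ⟨hw, n.over_def m ▸ hm⟩

theorem ringKrullDim_le_of_isIntegral (R S : Type*) [CommRing R] [CommRing S] [Algebra R S]
    [Algebra.IsIntegral R S] [FaithfulSMul R S] : ringKrullDim R ≤ ringKrullDim S := by
  refine iSup_le fun l => ?_
  obtain ⟨Q, _, _⟩ := Ideal.nonempty_primesOver (S := S) l.head.asIdeal
  obtain ⟨L, hL, -⟩ := Ideal.exists_ltSeries_of_hasGoingUp l Q
  rw [← hL]
  exact le_iSup (fun L : LTSeries (PrimeSpectrum S) => (L.length : WithBot ℕ∞)) L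

variable {k : Type u} [Field k] {δ : ℕ}

theorem X_pow_mem_ratNormalCurve (i : Fin 2) :
    (X i ^ δ : MvPolynomial (Fin 2) k) ∈ ratNormalCurve k δ :=
  mem_ratNormalCurve_iff.2 (by simpa using (isWeightedHomogeneous_X k (1 : Fin 2 → ZMod δ) i).pow δ)

theorem mem_homMaxIdeal_of_X_dvd {i : Fin 2} {r : ratNormalCurve k δ}
    (h : X i ∣ (r : MvPolynomial (Fin 2) k)) : r ∈ homMaxIdeal k δ := by
  obtain ⟨g, hg⟩ := h
  rw [mem_homMaxIdeal_iff, hg, map_mul, constantCoeff_X, zero_mul]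

theorem isIntegral_ratNormalCurve (hδ : 0 < δ) :
    Algebra.IsIntegral (ratNormalCurve k δ) (MvPolynomial (Fin 2) k) := by
  refine ⟨fun f => ?_⟩
  induction f using MvPolynomial.induction_on with
  | C c => exact isIntegral_algebraMap (R := ratNormalCurve k δ) (x := algebraMap k _ c)
  | add f g hf hg => exact hf.add hg
  | mul_X f i hf =>
    exact hf.mul <| .of_pow hδ <|
      isIntegral_algebraMap (R := ratNormalCurve k δ) (x := ⟨_, X_pow_mem_ratNormalCurve i⟩)

variable (k) in
theorem ringKrullDim_ratNormalCurve_le (hδ : 0 < δ) : ringKrullDim (ratNormalCurve k δ) ≤ 2 := by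
  have := isIntegral_ratNormalCurve (k := k) hδ
  refine (ringKrullDim_le_of_isIntegral _ (MvPolynomial (Fin 2) k)).trans ?_
  rw [MvPolynomial.ringKrullDim_of_isNoetherianRing, ringKrullDim_eq_zero_of_field]
  simp

variable (k) in
theorem two_le_height_homMaxIdeal (hδ : 0 < δ) : 2 ≤ (homMaxIdeal k δ).height := by
  let P : Ideal (ratNormalCurve k δ) := (Ideal.span {(X 1 : MvPolynomial (Fin 2) k)}).comap
    (algebraMap (ratNormalCurve k δ) (MvPolynomial (Fin 2) k))
  have : (Ideal.span {(X 1 : MvPolynomial (Fin 2) k)}).IsPrime :=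
    (Ideal.span_singleton_prime (X_ne_zero 1)).2 X_prime
  have : P.IsPrime := Ideal.comap_isPrime _ _
  have hP (r : ratNormalCurve k δ) : r ∈ P ↔ X 1 ∣ (r : MvPolynomial (Fin 2) k) :=
    Ideal.mem_span_singleton
  have h_bot : ⊥ < P := by
    refine (Submodule.ne_bot_iff P).2 ⟨⟨_, X_pow_mem_ratNormalCurve 1⟩,
      (hP _).2 (dvd_pow_self _ hδ.ne'), fun h => ?_⟩ |>.bot_lt
    exact pow_ne_zero δ (X_ne_zero 1) (congrArg Subtype.val h)
  have h_lt : P < homMaxIdeal k δ := by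
    refine SetLike.lt_iff_le_and_exists.2 ⟨fun r hr => mem_homMaxIdeal_of_X_dvd ((hP r).1 hr),
      ⟨_, X_pow_mem_ratNormalCurve 0⟩, mem_homMaxIdeal_of_X_dvd (dvd_pow_self _ hδ.ne'),
      fun h => ?_⟩
    exact absurd (X_dvd_X.1 (X_prime.dvd_of_dvd_pow ((hP _).1 h))) (by decide)
  have : (⊥ : Ideal (ratNormalCurve k δ)).IsPrime := Ideal.isPrime_bot
  have : (homMaxIdeal k δ).IsPrime := Ideal.IsMaximal.isPrime inferInstance
  calc (2 : ℕ∞) = 1 + 1 := by norm_num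
    _ ≤ (⊥ : Ideal (ratNormalCurve k δ)).height + 1 + 1 := by gcongr; exact le_add_self
    _ ≤ P.height + 1 := by gcongr; exact Ideal.height_add_one_le_of_lt_of_isPrime h_bot
    _ ≤ _ := Ideal.height_add_one_le_of_lt_of_isPrime h_lt

theorem mem_homMaxIdeal_of_X_mul_eq_X_mul {i i' : Fin 2} (hi : i ≠ i') {r s : ratNormalCurve k δ}
    {g : MvPolynomial (Fin 2) k} (hs : s ∉ homMaxIdeal k δ)
    (h : X i * (r * s : MvPolynomial (Fin 2) k) = X i' * g) : r ∈ homMaxIdeal k δ := by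
  have h_dvd : X i' ∣ X i * (r * s : MvPolynomial (Fin 2) k) := ⟨g, h⟩
  rcases X_prime.dvd_or_dvd
    ((X_prime.dvd_or_dvd h_dvd).resolve_left (mt X_dvd_X.1 hi.symm)) with hr | hs'
  · exact mem_homMaxIdeal_of_X_dvd hr
  · exact absurd (mem_homMaxIdeal_of_X_dvd hs') hs

variable (W : Submonoid (ratNormalCurve k δ)) {A : Type u} [CommRing A]
  [Algebra (ratNormalCurve k δ) A] [IsLocalization W A] (n : Ideal A)
  [n.LiesOver (homMaxIdeal k δ)]

include W in
theorem map_homMaxIdeal_eq_of_liesOver :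
    (homMaxIdeal k δ).map (algebraMap (ratNormalCurve k δ) A) = n := by
  rw [n.over_def (homMaxIdeal k δ), IsLocalization.map_under W]

variable [n.IsMaximal]

include W n in
theorem ringKrullDim_eq_two_of_liesOver (hδ : 0 < δ) : ringKrullDim A = (2 : ℕ) := by
  apply le_antisymm
  · refine (ringKrullDim_le_iff_height_le _).2 fun J hJ => ?_
    rw [← IsLocalization.height_under W]
    exact (Ideal.height_le_ringKrullDim_of_ne_top (Ideal.IsPrime.ne_top inferInstance)).trans
      (ringKrullDim_ratNormalCurve_le k hδ)
  · have h_height : 2 ≤ n.height := by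
      rw [← IsLocalization.height_under W, ← n.over_def (homMaxIdeal k δ)]
      exact two_le_height_homMaxIdeal k hδ
    exact (WithBot.coe_le_coe.2 h_height).trans
      (Ideal.height_le_ringKrullDim_of_ne_top (Ideal.IsMaximal.ne_top ‹n.IsMaximal›))

include W in
theorem pow_surjective_quotient_of_liesOver (p : ℕ) [Fact p.Prime] [CharP k p] [PerfectRing k p]
    (e : ℕ) : Function.Surjective fun x : A ⧸ n => x ^ p ^ e := by
  intro x
  have h_max : (n.under (ratNormalCurve k δ)).IsMaximal :=
    n.over_def (homMaxIdeal k δ) ▸ homMaxIdeal_isMaximal k δ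
  obtain ⟨x, rfl⟩ := IsLocalization.surjective_quotientMap_of_maximal_of_localization W A
    (H := le_rfl) h_max x
  obtain ⟨r, rfl⟩ := Ideal.Quotient.mk_surjective x
  obtain ⟨c, hc⟩ := (bijective_iterateFrobenius k p e).2 (constantCoeff r.1)
  refine ⟨Ideal.Quotient.mk n (algebraMap _ A (algebraMap k (ratNormalCurve k δ) c)), ?_⟩
  have h_sub : algebraMap k (ratNormalCurve k δ) (c ^ p ^ e) - r ∈ homMaxIdeal k δ := by
    rw [← iterateFrobenius_def, hc, mem_homMaxIdeal_iff]
    exact (map_sub _ _ _).trans (sub_eq_zero.2 (constantCoeff_C _ _))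
  rw [n.mem_of_liesOver (homMaxIdeal k δ), map_sub, map_pow, map_pow] at h_sub
  exact Ideal.Quotient.eq.2 h_sub

namespace Covariants

variable {c : ZMod δ}

include W in
theorem apply_mem_of_X_mul_eq_X_mul (hδ : 0 < δ) {i i' : Fin 2} (hi : i ≠ i')
    {u v : Covariants k δ c} (h : X i * toPoly k δ c u = X i' * toPoly k δ c v)
    (f : Covariants k δ c →ₗ[ratNormalCurve k δ] A) : f u ∈ n := by
  have hW : W ≤ (homMaxIdeal k δ).primeCompl :=
    le_primeCompl_of_liesOver W (Ideal.IsMaximal.ne_top ‹n.IsMaximal›)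
  have h_mem (l : Fin 2) : (X l * X 0 ^ (δ - 1) : MvPolynomial (Fin 2) k) ∈ ratNormalCurve k δ := by
    simpa [mem_ratNormalCurve_iff, Nat.cast_sub hδ] using
      (isWeightedHomogeneous_X k (1 : Fin 2 → ZMod δ) l).mul
        ((isWeightedHomogeneous_X k 1 0).pow (δ - 1))
  have h_smul : (⟨_, h_mem i⟩ : ratNormalCurve k δ) • u =
      (⟨_, h_mem i'⟩ : ratNormalCurve k δ) • v :=
    toPoly_injective <| by
      simp only [map_smul, Subalgebra.smul_def, smul_eq_mul]
      linear_combination X 0 ^ (δ - 1) * h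
  obtain ⟨⟨r, s⟩, hr⟩ := IsLocalization.surj W (f u)
  obtain ⟨⟨r', s'⟩, hr'⟩ := IsLocalization.surj W (f v)
  dsimp only at hr hr'
  have h_eq : (⟨_, h_mem i⟩ * (r * s') : ratNormalCurve k δ) = ⟨_, h_mem i'⟩ * (r' * s) := by
    refine IsLocalization.injective A (hW.trans (Ideal.primeCompl_le_nonZeroDivisors _)) ?_
    have h_apply := congrArg f h_smul
    rw [map_smul, map_smul, Algebra.smul_def, Algebra.smul_def] at h_apply
    simp only [map_mul, ← hr, ← hr']
    linear_combination (algebraMap _ A s.1 * algebraMap _ A s'.1) * h_apply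
  have h_poly : X i * (r.1 * s'.1.1) = X i' * (r'.1 * s.1.1) := by
    refine mul_left_cancel₀ (pow_ne_zero (δ - 1) (X_ne_zero 0)) ?_
    rw [mul_left_comm, ← mul_assoc, mul_left_comm _ (X i'), ← mul_assoc (X i')]
    exact congrArg Subtype.val h_eq
  have hr_mem : f u * algebraMap _ A s.1 ∈ n := by
    rw [hr, ← n.mem_of_liesOver (homMaxIdeal k δ)]
    exact mem_homMaxIdeal_of_X_mul_eq_X_mul hi (hW s'.2) h_poly
  exact (Ideal.mul_unit_mem_iff_mem n (IsLocalization.map_units A s)).1 hr_mem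

theorem exists_X_mul_gen_eq_X_mul_gen {j : ℕ} (hj : j ≠ 0) (l : Fin (j + 1)) :
    ∃ i i' : Fin 2, i ≠ i' ∧ ∃ l' : Fin (j + 1),
      X i * toPoly k δ j (gen k δ j l) = X i' * toPoly k δ j (gen k δ j l') := by
  have h_next (b : ℕ) (hb : b < j) :
      X 0 * toPoly k δ j (gen k δ j ⟨b + 1, by omega⟩) =
        X 1 * toPoly k δ j (gen k δ j ⟨b, by omega⟩) := by
    rw [toPoly_gen, toPoly_gen, show j - b = j - (b + 1) + 1 by omega]
    ring
  obtain ⟨_ | b, hl⟩ := l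
  · exact ⟨1, 0, by decide, _, (h_next 0 (by omega)).symm⟩
  · exact ⟨0, 1, by decide, _, h_next b (by omega)⟩

include W in
theorem baseChange_apply_mem {j : ℕ} (hj₀ : j ≠ 0) (hj : j < δ)
    (f : A ⊗[ratNormalCurve k δ] Covariants k δ j →ₗ[A] A)
    (x : A ⊗[ratNormalCurve k δ] Covariants k δ j) : f x ∈ n := by
  refine apply_mem_of_span_eq_top (span_gen hj) (fun g u hu => ?_) f x
  obtain ⟨l, rfl⟩ := hu
  obtain ⟨i, i', hi, l', h⟩ := exists_X_mul_gen_eq_X_mul_gen (k := k) (δ := δ) hj₀ l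
  exact apply_mem_of_X_mul_eq_X_mul W n (by omega) hi h g

variable (k δ) in
/-- The covariants of class `0` are the elements of the ring. -/
def zeroEquiv : Covariants k δ 0 ≃ₗ[ratNormalCurve k δ] ratNormalCurve k δ where
  toFun f := ⟨toPoly k δ 0 f, mem_ratNormalCurve_iff.2 (isWeightedHomogeneous_toPoly f)⟩
  invFun r := mk r (mem_ratNormalCurve_iff.1 r.2)
  left_inv _ := rfl
  right_inv _ := rfl
  map_add' _ _ := rfl
  map_smul' _ _ := rfl

end Covariants

end Vertex

/-! ### The invariants -/

section Invariants

theorem sum_fin_natCast (δ : ℕ) : ∑ j : Fin δ, ((j : ℕ) : ℝ) = δ * (δ - 1) / 2 := by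
  induction δ with
  | zero => simp
  | succ δ ih =>
    simp only [Fin.sum_univ_castSucc, Fin.val_castSucc, Fin.val_last, ih]
    push_cast
    ring

variable {k : Type u} [Field k] {δ : ℕ} (W : Submonoid (ratNormalCurve k δ)) {A : Type u}
  [CommRing A] [Algebra (ratNormalCurve k δ) A] [IsLocalization W A]

section Syzygies

variable (n : Ideal A) [n.LiesOver (homMaxIdeal k δ)]

include W in
theorem Covariants.isMinimalSyzygy_baseChange {j : ℕ} (hj : j < δ) :
    IsMinimalSyzygy n (Fin (j + 1)) (Fin j → A ⊗[ratNormalCurve k δ] Covariants k δ (-1))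
      (A ⊗[ratNormalCurve k δ] Covariants k δ j) := by
  have := IsLocalization.flat A W
  rw [← map_homMaxIdeal_eq_of_liesOver W n]
  exact ((Covariants.isMinimalSyzygy (k := k) hj).baseChange A).congr
    (TensorProduct.piRight (ratNormalCurve k δ) A A _).symm (.refl A _)

include W in
theorem Covariants.isMinimalSyzygy_baseChange_neg_one (hδ : 0 < δ) :
    IsMinimalSyzygy n (Fin δ) (Fin (δ - 1) → A ⊗[ratNormalCurve k δ] Covariants k δ (-1))
      (A ⊗[ratNormalCurve k δ] Covariants k δ (-1)) := by
  have h := isMinimalSyzygy_baseChange W n (Nat.sub_lt hδ one_pos)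
  rwa [Nat.cast_pred hδ, ZMod.natCast_self, zero_sub, Nat.sub_one_add_one hδ.ne'] at h

end Syzygies

variable (p : ℕ) [Fact p.Prime] [CharP k p] [PerfectRing k p] [CharP A p]

/-- The decomposition of the Frobenius pushforward of a localization of the rational normal curve
into localized modules of covariants. -/
def frobPushEquivOfIsLocalization (hδ : 0 < δ) (e : ℕ) :
    (∀ t : FrobIndex (p ^ e) δ, A ⊗[ratNormalCurve k δ] Covariants k δ (t.1 : ℕ)) ≃ₗ[A]
      FrobPush A p e :=
  (TensorProduct.piRight _ A A _).symm ≪≫ₗ (frobPushEquiv k p e δ hδ).baseChange _ A _ _ ≪≫ₗ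
    FrobPush.tensorEquiv _ p W A e

variable (n : Ideal A) [n.LiesOver (homMaxIdeal k δ)]

include W in
theorem isMinimalSyzygy_frobPush (hδ : 0 < δ) (e : ℕ) :
    IsMinimalSyzygy n (Σ t : FrobIndex (p ^ e) δ, Fin (t.1 + 1))
      ((Σ t : FrobIndex (p ^ e) δ, Fin t.1) → A ⊗[ratNormalCurve k δ] Covariants k δ (-1))
      (FrobPush A p e) :=
  (IsMinimalSyzygy.pi fun t : FrobIndex (p ^ e) δ =>
    Covariants.isMinimalSyzygy_baseChange W n t.1.2).congr
      (LinearEquiv.piCurry A fun (t : FrobIndex (p ^ e) δ) (_ : Fin t.1) =>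
        A ⊗[ratNormalCurve k δ] Covariants k δ (-1))
      (frobPushEquivOfIsLocalization W p hδ e)

include W n in
theorem frobenius_finite (hδ : 0 < δ) : (frobenius A p).Finite := by
  have h_fin : (iterateFrobenius A p 1).Finite := (isMinimalSyzygy_frobPush W p n hδ 1).finite
  rwa [iterateFrobenius_one] at h_fin

variable [n.IsMaximal]

include W in
theorem residueDegree_eq_one_of_liesOver : residueDegree p A n = 1 :=
  residueDegree_eq_one (by simpa using pow_surjective_quotient_of_liesOver W n p 1)

include W in
theorem hasHilbertKunzMultiplicity (hδ : 0 < δ) :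
    HasHilbertKunzMultiplicity p A n ((δ + 1) / 2) := by
  refine ⟨2, fun e => Nat.card (Σ t : FrobIndex (p ^ e) δ, Fin (t.1 + 1)),
    ringKrullDim_eq_two_of_liesOver W n hδ, fun e => ?_, ?_⟩
  · rw [length_quotient_frobPower p e n (pow_surjective_quotient_of_liesOver W n p e),
      (isMinimalSyzygy_frobPush W p n hδ e).length_quotient]
  · have h_mean : (∑ j : Fin δ, ((j : ℕ) + 1 : ℝ)) / δ = (δ + 1) / 2 := by
      rw [Finset.sum_add_distrib, sum_fin_natCast, Fin.sum_const, nsmul_one]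
      field_simp
      ring
    rw [← h_mean]
    refine (tendsto_sum_frobIndex_div hδ (Fact.out : p.Prime).one_lt _).congr fun e => ?_
    simp

include W n in
theorem isGreatest_hasFreeSummand_frobPush (hδ : 0 < δ) (e : ℕ) :
    IsGreatest {c | HasFreeSummand A (FrobPush A p e) c}
      (Nat.card {t : FrobIndex (p ^ e) δ // (t.1 : ℕ) = 0}) := by
  have h_free (t : FrobIndex (p ^ e) δ) (ht : (t.1 : ℕ) = 0) :
      Nonempty (A ⊗[ratNormalCurve k δ] Covariants k δ (t.1 : ℕ) ≃ₗ[A] A) := by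
    rw [ht, Nat.cast_zero]
    exact ⟨(Covariants.zeroEquiv k δ).baseChange _ A _ _ ≪≫ₗ
      TensorProduct.AlgebraTensorModule.rid _ A A⟩
  have ε := frobPushEquivOfIsLocalization W (A := A) p hδ e
  refine ⟨(hasFreeSummand_card h_free).congr ε, fun c hc => ?_⟩
  exact ((hasFreeSummand_congr ε).2 hc).le_card (m := n) h_free fun t ht =>
    Covariants.baseChange_apply_mem W n ht t.1.2

include W in
theorem hasFSignature (hδ : 0 < δ) : HasFSignature p A n (1 / δ) := by
  refine ⟨frobenius_finite W p n hδ, 2, _, ringKrullDim_eq_two_of_liesOver W n hδ,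
    isGreatest_hasFreeSummand_frobPush W p n hδ, ?_⟩
  have h_sum : ∑ j : Fin δ, (if (j : ℕ) = 0 then 1 else 0 : ℝ) = 1 := by
    obtain ⟨δ, rfl⟩ := Nat.exists_eq_succ_of_ne_zero hδ.ne'
    simp
  rw [← h_sum]
  refine (tendsto_sum_frobIndex_div hδ (Fact.out : p.Prime).one_lt _).congr fun e => ?_
  rw [residueDegree_eq_one_of_liesOver W p n, Finset.sum_boole, Nat.card_eq_fintype_card,
    Fintype.card_subtype, Nat.cast_one, one_pow, one_mul]

include W in
theorem hasFrobeniusBetti_succ (hδ : 0 < δ) (i : ℕ) :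
    HasFrobeniusBetti p A n (i + 1) (δ * (δ - 1) ^ (i + 1) / 2) := by
  refine ⟨frobenius_finite W p n hδ, 2, _, ringKrullDim_eq_two_of_liesOver W n hδ,
    fun e => betti_succ_eq (isMinimalSyzygy_frobPush W p n hδ e)
      (Covariants.isMinimalSyzygy_baseChange_neg_one W n hδ) i, ?_⟩
  have h_mean : (∑ j : Fin δ, ((j : ℕ) : ℝ)) / δ * ((δ - 1) ^ i * δ) =
      δ * (δ - 1) ^ (i + 1) / 2 := by
    rw [sum_fin_natCast]
    field_simp
    ring
  rw [← h_mean]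
  refine ((tendsto_sum_frobIndex_div hδ (Fact.out : p.Prime).one_lt _).mul_const _).congr
    fun e => ?_
  rw [residueDegree_eq_one_of_liesOver W p n, Nat.card_sigma]
  simp only [Nat.card_fin]
  push_cast [Nat.cast_sub hδ]
  ring

end Invariants

end FrobeniusBetti

end

theorem theorem4_general {k : Type u} [Field k] (p : ℕ) [Fact p.Prime] [CharP k p] [PerfectRing k p]
    (δ : ℕ) (hδ : 1 ≤ δ) (W : Submonoid (ratNormalCurve k δ)) (A : Type u) [CommRing A] [CharP A p]
    [Algebra (ratNormalCurve k δ) A] [IsLocalization W A] (n : Ideal A) [n.IsMaximal]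
    [n.LiesOver (homMaxIdeal k δ)] :
    HasFSignature p A n (1 / δ) ∧ HasHilbertKunzMultiplicity p A n ((δ + 1) / 2) ∧
      ∀ i : ℕ, 1 ≤ i → HasFrobeniusBetti p A n i (δ * (δ - 1) ^ i / 2) := by
  refine ⟨hasFSignature W p n hδ, hasHilbertKunzMultiplicity W p n hδ, fun i hi => ?_⟩
  rw [← Nat.sub_add_cancel hi]
  exact hasFrobeniusBetti_succ W p n hδ (i - 1)

theorem theorem4 {k : Type u} [Field k] [IsAlgClosed k] (p : ℕ) [Fact p.Prime] [CharP k p]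
    (δ : ℕ) (hδ : 2 ≤ δ) :
    -- the graded ring `R = k[x^δ, x^(δ-1) y, …, y^δ]` with its homogeneous maximal ideal
    (HasFSignature p (ratNormalCurve k δ) (homMaxIdeal k δ) (1 / δ) ∧
      HasHilbertKunzMultiplicity p (ratNormalCurve k δ) (homMaxIdeal k δ) ((δ + 1) / 2) ∧
      ∀ i : ℕ, 1 ≤ i →
        HasFrobeniusBetti p (ratNormalCurve k δ) (homMaxIdeal k δ) i (δ * (δ - 1) ^ i / 2)) ∧
    -- the local ring `R_m`
    (HasFSignature p (ratNormalCurveLocal k δ)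
        (IsLocalRing.maximalIdeal (ratNormalCurveLocal k δ)) (1 / δ) ∧
      HasHilbertKunzMultiplicity p (ratNormalCurveLocal k δ)
        (IsLocalRing.maximalIdeal (ratNormalCurveLocal k δ)) ((δ + 1) / 2) ∧
      ∀ i : ℕ, 1 ≤ i →
        HasFrobeniusBetti p (ratNormalCurveLocal k δ)
          (IsLocalRing.maximalIdeal (ratNormalCurveLocal k δ)) i (δ * (δ - 1) ^ i / 2)) := by
  have : IsLocalization (⊥ : Submonoid (ratNormalCurve k δ)) (ratNormalCurve k δ) :=
    IsLocalization.self bot_le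
  have : (homMaxIdeal k δ).LiesOver (homMaxIdeal k δ) := ⟨(Ideal.comap_id _).symm⟩
  exact ⟨theorem4_general p δ (by omega) (k := k) ⊥ _ _,
    theorem4_general p δ (by omega) (homMaxIdeal k δ).primeCompl _ _⟩
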